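/- Let $H$ be a complex Hilbert space with inner product $(\cdot,\cdot)$, let $V\subset H$ be a dense subspace and let $a$ be a closed, Hermitian, positive-definite sesquilinear form on $V$. Put $\|u\|_V:=a(u,u)^{1/2}$ and let $A$ be the selfadjoint operator in $H$ associated with $a$, so that $\|u\|_V=\|A^{1/2}u\|$ for $u\in V$. Assume that $H$ has an orthonormal basis $\{\psi_n\}_{n\ge1}$ of eigenvectors of $A$, $A\psi_n=\mu_n\psi_n$, and that there are $\gamma>0$, $\kappa>0$, $N_0\ge1$ with $$\mu_{k+1}-\mu_k\ \ge\ \kappa\,k^{\gamma-1}\qquad\text{for all }k\ge N_0 .$$ Let $b$ be a complex-valued sesquilinear form on $V$ that is continuous in each argument with respect to $\|\cdot\|_V$, and assume that for some $\alpha\in\mathbb R$, $M_b>0$ $$|b(\psi_m,\psi_n)|\ \le\ \frac{M_b}{m^{\alpha}n^{\alpha}}\qquad\text{for all }m,n\ge1 .$$ Let $T$ be the operator associated with $t=a+b$: $u\in V$ belongs to $D(T)$ and $Tu=f\in H$ if and only if $t(u,v)=(f,v)$ for all $v\in V$. For $n\geq 1$ let $$\Pi_n=\Big\{z\in\mathbb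 C:\ \mu_n-\tfrac{\kappa}{2}(n-1)^{\gamma-1}<\operatorname{Re}z<\mu_n+\tfrac{\kappa}{2}n^{\gamma-1},\ |\operatorname{Im}z|<\tfrac{\kappa}{2}n^{\gamma-1}\Big\},$$ and let $\Gamma_n=\partial\Pi_n$, oriented counterclockwise. Assume $$2\alpha+\gamma>\tfrac32\ \text{ if }\alpha\le1,\qquad 2\alpha+\gamma>1\ \text{ if }\alpha>1 .$$ Then there is $N$ such that for all $n\ge N$ the contour $\Gamma_n$ lies in the resolvent set of $T$, the spectrum of $T$ in $\Pi_n$ consists of exactly one point $\lambda_n$, this point is an eigenvalue of algebraic multiplicity one, and $$\phi_n:=\frac1{2\pi i}\int_{\Gamma_n}(z-T)^{-1}\psi_n\,dz$$ is an eigenvector of $T$ for $\lambda_n$. Moreover, if $\{\phi_n\}_{n\ge1}\subset V$ is any sequence whose members are given by this formula for all sufficiently large $n$ (the finitely many others being arbitrary), then $\{\mu_n^{-1/2}\phi_n\}$ is quadratically close to $\{\mu_n^{-1/2}\psi_n\}$ in the $V$-norm: $$\sum_{n=1}^\infty\big\|\mu_n^{-1/2}\psi_n-\mu_n^{-1/2}\phi_n\big\|_V^2<\infty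 .$$ -/

import Mathlib

open scoped InnerProductSpace

noncomputable section

namespace FormPerturbation

variable {H : Type*} [NormedAddCommGroup H] [InnerProductSpace ℂ H]

/-- A sesquilinear form on the subspace `V`, linear in the first and conjugate-linear in the
second argument. The inner product `(u, v)` with the same convention is `⟪v, u⟫_ℂ`. -/
abbrev SesqForm (V : Submodule ℂ H) := V →ₗ[ℂ] V →ₗ⋆[ℂ] ℂ

/-- `a(u, v)` is the complex conjugate of `a(v, u)`. -/
def IsHermitianForm {V : Submodule ℂ H} (a : SesqForm V) : Prop :=
  ∀ u v : V, a u v = starRingEnd ℂ (a v u)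

/-- `a(u, u) > 0` for all `u ≠ 0` (the imaginary part vanishes for Hermitian forms). -/
def IsPosDefForm {V : Submodule ℂ H} (a : SesqForm V) : Prop :=
  ∀ u : V, u ≠ 0 → 0 < (a u u).re

/-- Closedness of a nonnegative form in the sense of Kato: if `u k ∈ V` converges to `w` in `H`
and `a[u j - u k] → 0` as `j, k → ∞`, then `w ∈ V` and `a[u k - w] → 0`. -/
def IsClosedForm {V : Submodule ℂ H} (a : SesqForm V) : Prop :=
  ∀ (u : ℕ → V) (w : H),
    Filter.Tendsto (fun k => (u k : H)) Filter.atTop (nhds w) →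
    (∀ ε : ℝ, 0 < ε → ∃ K : ℕ, ∀ j k : ℕ, K ≤ j → K ≤ k →
      (a (u j - u k) (u j - u k)).re < ε) →
    ∃ hw : w ∈ V,
      Filter.Tendsto (fun k => (a (u k - ⟨w, hw⟩) (u k - ⟨w, hw⟩)).re) Filter.atTop (nhds 0)

/-- The energy norm `‖u‖_V = a(u, u)^{1/2}`. -/
def energyNorm {V : Submodule ℂ H} (a : SesqForm V) (u : V) : ℝ :=
  Real.sqrt (a u u).re

/-- `b` is continuous in each of its arguments separately, with respect to the energy norm
of `a`. -/
def IsSeparatelyContinuous {V : Submodule ℂ H} (a b : SesqForm V) : Prop :=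
  (∀ v : V, ∃ C : ℝ, ∀ u : V, ‖b u v‖ ≤ C * energyNorm a u) ∧
  (∀ u : V, ∃ C : ℝ, ∀ v : V, ‖b u v‖ ≤ C * energyNorm a v)

/-- The graph of the operator associated with the form `t`: all pairs `(u, f)` with `u ∈ V` and
`t(u, v) = (f, v)` for every `v ∈ V`. -/
def formGraph {V : Submodule ℂ H} (t : SesqForm V) : Submodule ℂ (H × H) where
  carrier := {p | ∃ hu : p.1 ∈ V, ∀ v : V, t ⟨p.1, hu⟩ v = ⟪(v : H), p.2⟫_ℂ}
  zero_mem' := by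
    refine ⟨V.zero_mem, fun v => ?_⟩
    have h : (⟨(0 : H × H).1, V.zero_mem⟩ : V) = 0 := rfl
    rw [h]
    simp
  add_mem' := by
    rintro p q ⟨hp, hp'⟩ ⟨hq, hq'⟩
    refine ⟨V.add_mem hp hq, fun v => ?_⟩
    have h : (⟨(p + q).1, V.add_mem hp hq⟩ : V) = ⟨p.1, hp⟩ + ⟨q.1, hq⟩ := rfl
    rw [h, map_add, LinearMap.add_apply, hp' v, hq' v, Prod.snd_add, inner_add_right]
  smul_mem' := by
    rintro c p ⟨hp, hp'⟩
    refine ⟨V.smul_mem c hp, fun v => ?_⟩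
    have h : (⟨(c • p).1, V.smul_mem c hp⟩ : V) = c • ⟨p.1, hp⟩ := rfl
    rw [h, map_smul, LinearMap.smul_apply, hp' v, Prod.smul_snd, inner_smul_right, smul_eq_mul]

/-- The (unbounded) operator in `H` associated with the form `t` with dense domain `V`. -/
def formOperator {V : Submodule ℂ H} (t : SesqForm V) : H →ₗ.[ℂ] H :=
  (formGraph t).toLinearPMap

/-- For a dense form domain the operator really has the graph `formGraph t`. -/
theorem formOperator_graph {V : Submodule ℂ H} (hV : Dense (V : Set H)) (t : SesqForm V) :
    (formOperator t).graph = formGraph t := by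
  refine Submodule.toLinearPMap_graph_eq _ ?_
  rintro ⟨u, f⟩ ⟨hu, hf⟩ h0
  have hu0 : u = 0 := h0
  subst hu0
  refine hV.eq_zero_of_inner_right ℂ fun v hv => ?_
  have h := hf ⟨v, hv⟩
  rw [show (⟨((0 : H), f).1, hu⟩ : V) = 0 from rfl] at h
  simpa using h.symm

/-- `u` is an eigenvector of `T` for the eigenvalue `z`. -/
def IsEigenpair (T : H →ₗ.[ℂ] H) (z : ℂ) (u : H) : Prop :=
  u ≠ 0 ∧ (u, z • u) ∈ T.graph

/-- `(T - z)^k u = 0`, including that `u, (T - z) u, …, (T - z)^{k-1} u` lie in the domain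
of `T`. -/
def IsRootVector (T : H →ₗ.[ℂ] H) (z : ℂ) : ℕ → H → Prop
  | 0, u => u = 0
  | k + 1, u => ∃ w : H, (u, z • u + w) ∈ T.graph ∧ IsRootVector T z k w

/-- `z` is an eigenvalue of `T` of algebraic multiplicity one with eigenvector `u`: the root
space of `z` is spanned by `u ≠ 0`. -/
def IsSimpleEigenpair (T : H →ₗ.[ℂ] H) (z : ℂ) (u : H) : Prop :=
  IsEigenpair T z u ∧ ∀ (k : ℕ) (w : H), IsRootVector T z k w → ∃ c : ℂ, w = c • u

/-- The bounded operator `R` on `H` is the two-sided inverse `(z - T)⁻¹`. -/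
def IsResolventAt (T : H →ₗ.[ℂ] H) (z : ℂ) (R : H →L[ℂ] H) : Prop :=
  (∀ f : H, ∃ h : R f ∈ T.domain, z • R f - T ⟨R f, h⟩ = f) ∧
  (∀ u : T.domain, R (z • (u : H) - T u) = u)

/-- The resolvent set of `T`. -/
def resolventSet (T : H →ₗ.[ℂ] H) : Set ℂ :=
  {z | ∃ R : H →L[ℂ] H, IsResolventAt T z R}

open Classical in
/-- The resolvent `(z - T)⁻¹`, with value `0` for `z` outside the resolvent set. -/
def resolventOp (T : H →ₗ.[ℂ] H) (z : ℂ) : H →L[ℂ] H :=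
  if h : ∃ R : H →L[ℂ] H, IsResolventAt T z R then h.choose else 0

/-- The bounded inverse of `z - T` is unique, so `resolventOp T z` is that inverse. -/
theorem IsResolventAt.eq_resolventOp {T : H →ₗ.[ℂ] H} {z : ℂ} {R : H →L[ℂ] H}
    (hR : IsResolventAt T z R) : resolventOp T z = R := by
  have h : ∃ R : H →L[ℂ] H, IsResolventAt T z R := ⟨R, hR⟩
  rw [resolventOp, dif_pos h]
  ext f
  obtain ⟨hf, hf'⟩ := hR.1 f
  have := h.choose_spec.2 ⟨R f, hf⟩
  rwa [hf'] at this

/-- The open rectangle of all `z` with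
`μ - (κ/2) (n-1)^{γ-1} < Re z < μ + (κ/2) n^{γ-1}` and `|Im z| < (κ/2) n^{γ-1}`. -/
def box (κ γ μ : ℝ) (n : ℕ+) : Set ℂ :=
  {z | μ - κ / 2 * ((n : ℝ) - 1) ^ (γ - 1) < z.re ∧ z.re < μ + κ / 2 * (n : ℝ) ^ (γ - 1) ∧
    |z.im| < κ / 2 * (n : ℝ) ^ (γ - 1)}

/-- The integral of `f` over the boundary of the rectangle `[x₀, x₁] × [y₀, y₁]`,
traversed counterclockwise. -/
def rectIntegral (f : ℂ → H) (x₀ x₁ y₀ y₁ : ℝ) : H :=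
  (∫ x in x₀..x₁, f (x + y₀ * Complex.I)) + Complex.I • (∫ y in y₀..y₁, f (x₁ + y * Complex.I))
    - (∫ x in x₀..x₁, f (x + y₁ * Complex.I)) - Complex.I • (∫ y in y₀..y₁, f (x₀ + y * Complex.I))

/-- `(2πi)⁻¹ ∫ (z - T)⁻¹ ψ dz` over the positively oriented boundary of `box κ γ μ n`. -/
def rieszVector (T : H →ₗ.[ℂ] H) (κ γ μ : ℝ) (n : ℕ+) (ψ : H) : H :=
  (2 * Real.pi * Complex.I : ℂ)⁻¹ •
    rectIntegral (fun z => resolventOp T z ψ)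
      (μ - κ / 2 * ((n : ℝ) - 1) ^ (γ - 1)) (μ + κ / 2 * (n : ℝ) ^ (γ - 1))
      (-(κ / 2 * (n : ℝ) ^ (γ - 1))) (κ / 2 * (n : ℝ) ^ (γ - 1))

end FormPerturbation

end

/-! Fix a large `n`. Write `T - z` in the basis `ψ` and rescale the `m`-th coordinate by `ρ m = |μ m
- μ n|^(-1/2)`, with `ρ n = δ^(-1/2)` and `δ` comparable to `n^(γ-1)`. With `S = diag ρ` and `u = S
x`, the equation `(T - z) u = g` becomes `(A - z S²) x = S g` with bounded operators: `A - z S²` is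
the diagonal matrix of entries `(μ m - z) ρ m²` plus the matrix `K` of entries `ρ i · b(ψ j, ψ i) ·
ρ j`. By the bound on `b`, `‖K‖ ≤ M ∑ m^(-2α) ρ m²`, and the gap condition makes this `O(n^(-r))`
for some `r > 0` because `2α + γ > 1`.

On the closed rectangle all diagonal entries except the `n`-th have modulus at least `1/2`.
Replacing that one entry by `1` yields an invertible operator, so `A - z S²` is singular exactly
where a scalar holomorphic function `f` vanishes (`isReducedPencil_of_isUnit`,
`exists_reducedPencil`). As `f` is close to `(μ n - z)/δ`, it has one zero `λ`, a simple one
(`exists_unique_zero`). A simple zero excludes Jordan chains, and the residue theorem turns the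
Riesz vector into `-(ρ n / f'(λ)) S Y(λ)`, where `Y(λ)` spans the kernel of the pencil
(`IsReducedPencil.exists_eigenvalue`).

The rank one bound on `K` is kept coordinate by coordinate, which gives `|(φ n - ψ n, ψ m)| ≤ 32 M
m^(-α) n^(-α) ρ m²` (`exists_eigenvalue_near`). Parseval in the energy norm and `μ m / μ n ≤ 1 + |μ
m - μ n| / μ n` then reduce quadratic closeness to two double series. One converges for `2α + γ >
1`, the other for `2α + γ > 3/2`. -/

open scoped InnerProductSpace

noncomputable section

namespace FormPerturbation

/-! ### Contour integrals over rectangles and zeros of perturbed affine functions -/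

section

open Complex in
theorem integral_inv_horizontal {w : ℂ} {x₀ x₁ y : ℝ} (hy : y ≠ w.im) :
    ∫ x in x₀..x₁, ((x + y * I : ℂ) - w)⁻¹
      = log ((x₁ + y * I : ℂ) - w) - log ((x₀ + y * I : ℂ) - w) := by
  have hs : ∀ x : ℝ, (x + y * I : ℂ) - w ∈ slitPlane := fun x =>
    Or.inr (by simpa using sub_ne_zero.2 hy)
  refine intervalIntegral.integral_eq_sub_of_hasDerivAt
    (f := fun x : ℝ => log ((x + y * I : ℂ) - w)) (fun x _ => ?_) ?_
  · have h1 : HasDerivAt (fun x : ℝ => (x + y * I : ℂ) - w) 1 x :=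
      ((Complex.ofRealCLM.hasDerivAt (x := x)).add_const _).sub_const w
    simpa using h1.clog_real (hs x)
  · refine ContinuousOn.intervalIntegrable ?_
    exact ContinuousOn.inv₀ (by fun_prop) fun x _ => slitPlane_ne_zero (hs x)

open Complex in
theorem integral_inv_vertical_right {w : ℂ} {x y₀ y₁ : ℝ} (hx : w.re < x) :
    I * ∫ y in y₀..y₁, ((x + y * I : ℂ) - w)⁻¹
      = log ((x + y₁ * I : ℂ) - w) - log ((x + y₀ * I : ℂ) - w) := by
  have hs : ∀ y : ℝ, (x + y * I : ℂ) - w ∈ slitPlane := fun y =>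
    Or.inl (by simpa using hx)
  rw [← intervalIntegral.integral_const_mul]
  refine intervalIntegral.integral_eq_sub_of_hasDerivAt
    (f := fun y : ℝ => log ((x + y * I : ℂ) - w)) (fun y _ => ?_) ?_
  · have h1 : HasDerivAt (fun y : ℝ => (x + y * I : ℂ) - w) I y := by
      simpa using (((Complex.ofRealCLM.hasDerivAt (x := y)).mul_const I).const_add (x : ℂ)).sub_const w
    simpa [div_eq_mul_inv] using h1.clog_real (hs y)
  · refine ContinuousOn.intervalIntegrable ?_
    exact continuousOn_const.mul
      (ContinuousOn.inv₀ (by fun_prop) fun y _ => slitPlane_ne_zero (hs y))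

-- The left side crosses the branch cut of `log (z - w)`, so the primitive `log (w - z)` is used
-- there. Its offsets from `log (z - w)` at the two left corners are what produces `2πi` in
-- `rectIntegral_inv_sub`.
open Complex in
theorem integral_inv_vertical_left {w : ℂ} {x y₀ y₁ : ℝ} (hx : x < w.re) :
    I * ∫ y in y₀..y₁, ((x + y * I : ℂ) - w)⁻¹
      = log (-((x + y₁ * I : ℂ) - w)) - log (-((x + y₀ * I : ℂ) - w)) := by
  have hs : ∀ y : ℝ, -((x + y * I : ℂ) - w) ∈ slitPlane := fun y =>
    Or.inl (by simpa using hx)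
  rw [← intervalIntegral.integral_const_mul]
  refine intervalIntegral.integral_eq_sub_of_hasDerivAt
    (f := fun y : ℝ => log (-((x + y * I : ℂ) - w))) (fun y _ => ?_) ?_
  · have h1 : HasDerivAt (fun y : ℝ => -((x + y * I : ℂ) - w)) (-I) y := by
      have := (((Complex.ofRealCLM.hasDerivAt (x := y)).mul_const I).const_add (x : ℂ)).sub_const w
      rw [ofRealCLM_apply, ofReal_one, one_mul] at this
      exact this.neg
    have h2 := h1.clog_real (hs y)
    rwa [neg_div_neg_eq, div_eq_mul_inv] at h2
  · refine ContinuousOn.intervalIntegrable ?_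
    exact continuousOn_const.mul (ContinuousOn.inv₀ (by fun_prop) fun y _ h =>
      slitPlane_ne_zero (hs y) (by rw [h, neg_zero]))

open Complex in
/-- The boundary of a rectangle winds once around each interior point. -/
theorem rectIntegral_inv_sub {w : ℂ} {x₀ x₁ y₀ y₁ : ℝ} (hx₀ : x₀ < w.re) (hx₁ : w.re < x₁)
    (hy₀ : y₀ < w.im) (hy₁ : w.im < y₁) :
    rectIntegral (fun z => (z - w)⁻¹) x₀ x₁ y₀ y₁ = 2 * Real.pi * I := by
  simp only [rectIntegral, smul_eq_mul]
  rw [integral_inv_horizontal hy₀.ne, integral_inv_horizontal hy₁.ne',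
    integral_inv_vertical_right hx₁, integral_inv_vertical_left hx₀]
  have h1 : log (-((x₀ + y₁ * I : ℂ) - w)) = log ((x₀ + y₁ * I : ℂ) - w) - Real.pi * I := by
    rw [log, log, norm_neg, arg_neg_eq_arg_sub_pi_of_im_pos (by simpa using hy₁)]
    push_cast; ring
  have h2 : log (-((x₀ + y₀ * I : ℂ) - w)) = log ((x₀ + y₀ * I : ℂ) - w) + Real.pi * I := by
    rw [log, log, norm_neg, arg_neg_eq_arg_add_pi_of_im_neg (by simpa using hy₀)]
    push_cast; ring
  rw [h1, h2]; ring

variable {E : Type*} [NormedAddCommGroup E] [InnerProductSpace ℂ E]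

open Complex in
theorem rectIntegral_congr {f g : ℂ → E} {x₀ x₁ y₀ y₁ : ℝ} {w : ℂ}
    (hx₀ : x₀ < w.re) (hx₁ : w.re < x₁) (hy₀ : y₀ < w.im) (hy₁ : w.im < y₁)
    (h : ∀ z ∈ Set.Icc x₀ x₁ ×ℂ Set.Icc y₀ y₁, z ≠ w → f z = g z) :
    rectIntegral f x₀ x₁ y₀ y₁ = rectIntegral g x₀ x₁ y₀ y₁ := by
  have hx := (hx₀.trans hx₁).le
  have hy := (hy₀.trans hy₁).le
  have hor : ∀ y ∈ Set.Icc y₀ y₁, y ≠ w.im →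
      ∫ x in x₀..x₁, f (x + y * I) = ∫ x in x₀..x₁, g (x + y * I) := fun y hy' hyw => by
    refine intervalIntegral.integral_congr fun x hx' => h _ ?_ fun he => hyw ?_
    · rw [Set.uIcc_of_le hx] at hx'
      simpa [mem_reProdIm] using And.intro hx' hy'
    · simpa using congrArg im he
  have ver : ∀ x ∈ Set.Icc x₀ x₁, x ≠ w.re →
      ∫ y in y₀..y₁, f (x + y * I) = ∫ y in y₀..y₁, g (x + y * I) := fun x hx' hxw => by
    refine intervalIntegral.integral_congr fun y hy' => h _ ?_ fun he => hxw ?_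
    · rw [Set.uIcc_of_le hy] at hy'
      simpa [mem_reProdIm] using And.intro hx' hy'
    · simpa using congrArg re he
  simp only [rectIntegral]
  rw [hor y₀ ⟨le_rfl, hy⟩ hy₀.ne, hor y₁ ⟨hy, le_rfl⟩ hy₁.ne', ver x₀ ⟨le_rfl, hx⟩ hx₀.ne,
    ver x₁ ⟨hx, le_rfl⟩ hx₁.ne']

open Complex in
theorem rectIntegral_eq_zero [CompleteSpace E] {f : ℂ → E} {x₀ x₁ y₀ y₁ : ℝ}
    (hx : x₀ ≤ x₁) (hy : y₀ ≤ y₁)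
    (hf : DifferentiableOn ℂ f (Set.Icc x₀ x₁ ×ℂ Set.Icc y₀ y₁)) :
    rectIntegral f x₀ x₁ y₀ y₁ = 0 := by
  have h := integral_boundary_rect_eq_zero_of_differentiableOn f (x₀ + y₀ * I) (x₁ + y₁ * I)
    (by simpa [Set.uIcc_of_le hx, Set.uIcc_of_le hy] using hf)
  rw [rectIntegral, ← h]
  simp only [add_re, ofReal_re, mul_re, I_re, mul_zero, ofReal_im, I_im, mul_one, sub_self,
    add_zero, add_im, mul_im, zero_add]
  abel

open Complex in
theorem rectIntegral_mul_smul [CompleteSpace E] (c : ℂ → ℂ) (v : E) (x₀ x₁ y₀ y₁ : ℝ) :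
    rectIntegral (fun z => c z • v) x₀ x₁ y₀ y₁ = rectIntegral c x₀ x₁ y₀ y₁ • v := by
  simp only [rectIntegral, intervalIntegral.integral_smul_const, smul_smul, sub_smul, add_smul,
    smul_eq_mul]

open Complex in
theorem rectIntegral_add {f g : ℂ → E} {x₀ x₁ y₀ y₁ : ℝ} {w : ℂ}
    (hx₀ : x₀ < w.re) (hx₁ : w.re < x₁) (hy₀ : y₀ < w.im) (hy₁ : w.im < y₁)
    (hf : ContinuousOn f ((Set.Icc x₀ x₁ ×ℂ Set.Icc y₀ y₁) \ {w}))
    (hg : ContinuousOn g ((Set.Icc x₀ x₁ ×ℂ Set.Icc y₀ y₁) \ {w})) :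
    rectIntegral (fun z => f z + g z) x₀ x₁ y₀ y₁
      = rectIntegral f x₀ x₁ y₀ y₁ + rectIntegral g x₀ x₁ y₀ y₁ := by
  have hx := (hx₀.trans hx₁).le
  have hy := (hy₀.trans hy₁).le
  have hor : ∀ k : ℂ → E, ContinuousOn k ((Set.Icc x₀ x₁ ×ℂ Set.Icc y₀ y₁) \ {w}) →
      ∀ y ∈ Set.Icc y₀ y₁, y ≠ w.im →
      IntervalIntegrable (fun x : ℝ => k (x + y * I)) MeasureTheory.volume x₀ x₁ := by
    intro k hk y hy' hyw
    refine ContinuousOn.intervalIntegrable (hk.comp (by fun_prop) fun x hx' => ⟨?_, fun he => hyw ?_⟩)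
    · rw [Set.uIcc_of_le hx] at hx'
      simpa [mem_reProdIm] using And.intro hx' hy'
    · simpa using congrArg im he
  have ver : ∀ k : ℂ → E, ContinuousOn k ((Set.Icc x₀ x₁ ×ℂ Set.Icc y₀ y₁) \ {w}) →
      ∀ x ∈ Set.Icc x₀ x₁, x ≠ w.re →
      IntervalIntegrable (fun y : ℝ => k (x + y * I)) MeasureTheory.volume y₀ y₁ := by
    intro k hk x hx' hxw
    refine ContinuousOn.intervalIntegrable (hk.comp (by fun_prop) fun y hy' => ⟨?_, fun he => hxw ?_⟩)
    · rw [Set.uIcc_of_le hy] at hy'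
      simpa [mem_reProdIm] using And.intro hx' hy'
    · simpa using congrArg re he
  have e0 := intervalIntegral.integral_add (hor f hf y₀ ⟨le_rfl, hy⟩ hy₀.ne)
    (hor g hg y₀ ⟨le_rfl, hy⟩ hy₀.ne)
  have e1 := intervalIntegral.integral_add (hor f hf y₁ ⟨hy, le_rfl⟩ hy₁.ne')
    (hor g hg y₁ ⟨hy, le_rfl⟩ hy₁.ne')
  have e2 := intervalIntegral.integral_add (ver f hf x₀ ⟨le_rfl, hx⟩ hx₀.ne)
    (ver g hg x₀ ⟨le_rfl, hx⟩ hx₀.ne)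
  have e3 := intervalIntegral.integral_add (ver f hf x₁ ⟨hx, le_rfl⟩ hx₁.ne')
    (ver g hg x₁ ⟨hx, le_rfl⟩ hx₁.ne')
  simp only [rectIntegral]
  rw [e0, e1, e2, e3, smul_add, smul_add]
  abel

theorem Icc_reProdIm_mem_nhds {x₀ x₁ y₀ y₁ : ℝ} {w : ℂ}
    (hx₀ : x₀ < w.re) (hx₁ : w.re < x₁) (hy₀ : y₀ < w.im) (hy₁ : w.im < y₁) :
    (Set.Icc x₀ x₁ ×ℂ Set.Icc y₀ y₁) ∈ nhds w :=
  Filter.inter_mem (Complex.continuous_re.continuousAt.preimage_mem_nhds (Icc_mem_nhds hx₀ hx₁))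
    (Complex.continuous_im.continuousAt.preimage_mem_nhds (Icc_mem_nhds hy₀ hy₁))

open Complex in
/-- Cauchy's integral formula for a rectangle. -/
theorem rectIntegral_inv_sub_smul [CompleteSpace E] {f : ℂ → E} {x₀ x₁ y₀ y₁ : ℝ} {w : ℂ}
    (hx₀ : x₀ < w.re) (hx₁ : w.re < x₁) (hy₀ : y₀ < w.im) (hy₁ : w.im < y₁)
    (hf : DifferentiableOn ℂ f (Set.Icc x₀ x₁ ×ℂ Set.Icc y₀ y₁)) :
    rectIntegral (fun z => (z - w)⁻¹ • f z) x₀ x₁ y₀ y₁ = (2 * Real.pi * I : ℂ) • f w := by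
  -- The difference quotient is holomorphic across `w`, so it integrates to zero and only the term
  -- `f w / (z - w)` remains.
  have hd := (differentiableOn_dslope (Icc_reProdIm_mem_nhds hx₀ hx₁ hy₀ hy₁)).2 hf
  have h0 := rectIntegral_eq_zero (hx₀.trans hx₁).le (hy₀.trans hy₁).le hd
  have hc : ContinuousOn (fun z : ℂ => (z - w)⁻¹ • f w)
      ((Set.Icc x₀ x₁ ×ℂ Set.Icc y₀ y₁) \ {w}) :=
    (ContinuousOn.inv₀ (by fun_prop) fun z hz => sub_ne_zero.2 hz.2).smul continuousOn_const
  have h1 := rectIntegral_add hx₀ hx₁ hy₀ hy₁ (hd.continuousOn.mono Set.sdiff_subset) hc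
  rw [h0, zero_add, rectIntegral_mul_smul, rectIntegral_inv_sub hx₀ hx₁ hy₀ hy₁] at h1
  rw [← h1]
  refine rectIntegral_congr hx₀ hx₁ hy₀ hy₁ fun z _ hz => ?_
  rw [dslope_of_ne _ hz, slope_def_module, ← smul_add, sub_add_cancel]

open Complex in
/-- The residue theorem for a rectangle and a single simple pole. -/
theorem rectIntegral_inv_smul [CompleteSpace E] {k : ℂ → ℂ} {f : ℂ → E} {x₀ x₁ y₀ y₁ : ℝ} {w : ℂ}
    (hx₀ : x₀ < w.re) (hx₁ : w.re < x₁) (hy₀ : y₀ < w.im) (hy₁ : w.im < y₁)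
    (hf : DifferentiableOn ℂ f (Set.Icc x₀ x₁ ×ℂ Set.Icc y₀ y₁))
    (hk : DifferentiableOn ℂ k (Set.Icc x₀ x₁ ×ℂ Set.Icc y₀ y₁))
    (hw : k w = 0) (hk' : deriv k w ≠ 0)
    (hk0 : ∀ z ∈ Set.Icc x₀ x₁ ×ℂ Set.Icc y₀ y₁, k z = 0 → z = w) :
    rectIntegral (fun z => (k z)⁻¹ • f z) x₀ x₁ y₀ y₁
      = (2 * Real.pi * I : ℂ) • (deriv k w)⁻¹ • f w := by
  -- Factor `k z = (z - w) * dslope k w z`. The second factor has no zero on the rectangle, and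
  -- Cauchy's formula applies to its inverse times `f`.
  have hd := (differentiableOn_dslope (Icc_reProdIm_mem_nhds hx₀ hx₁ hy₀ hy₁)).2 hk
  have hne : ∀ z ∈ Set.Icc x₀ x₁ ×ℂ Set.Icc y₀ y₁, dslope k w z ≠ 0 := by
    intro z hz h
    rcases eq_or_ne z w with rfl | hzw
    · exact hk' (by rwa [dslope_same] at h)
    · rw [dslope_of_ne _ hzw, slope_def_module, hw, sub_zero, smul_eq_mul, mul_eq_zero] at h
      rcases h with h | h
      · exact hzw (sub_eq_zero.1 (inv_eq_zero.1 h))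
      · exact hzw (hk0 z hz h)
  have h := rectIntegral_inv_sub_smul hx₀ hx₁ hy₀ hy₁ ((hd.inv hne).smul hf)
  simp only [Pi.smul_apply', Pi.inv_apply, dslope_same] at h
  rw [← h]
  refine rectIntegral_congr hx₀ hx₁ hy₀ hy₁ fun z _ hz => ?_
  have hz' := sub_ne_zero.2 hz
  rw [dslope_of_ne _ hz, slope_def_module, hw, sub_zero, smul_smul, smul_eq_mul, mul_inv, inv_inv,
    ← mul_assoc, inv_mul_cancel₀ hz', one_mul]

/-- A holomorphic perturbation of `z ↦ (c - z) / δ` has exactly one zero, and it is simple. -/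
theorem exists_unique_zero {k : ℂ → ℂ} {D : Set ℂ} {c : ℂ} {δ η : ℝ} (hδ : 0 < δ)
    (hη : η ≤ 1 / 8) (hD : Metric.closedBall c δ ⊆ D) (hk : ∀ z ∈ D, DifferentiableAt ℂ k z)
    (hkη : ∀ z ∈ D, ‖k z - (c - z) / δ‖ ≤ η) :
    ∃ w, ‖w - c‖ ≤ δ / 2 ∧ k w = 0 ∧ (∀ z ∈ D, k z = 0 → z = w) ∧
      ‖δ * deriv k w + 1‖ ≤ 2 * η := by
  have hδ' : (δ : ℂ) ≠ 0 := by exact_mod_cast hδ.ne'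
  -- Zeros of `k` are the fixed points of `z ↦ c + h z`. Here `‖h‖ ≤ δ η ≤ δ / 8`, and Cauchy's
  -- estimate on discs of radius `δ / 2` gives `‖h'‖ ≤ 2 η ≤ 1 / 4`, hence a contraction of the
  -- half-size ball.
  set h : ℂ → ℂ := fun z => δ * k z - (c - z) with hh
  have hdiff : ∀ z ∈ D, DifferentiableAt ℂ h z := fun z hz =>
    ((hk z hz).const_mul _).sub (by fun_prop)
  have hbd : ∀ z ∈ D, ‖h z‖ ≤ δ * η := fun z hz => by
    have : h z = δ * (k z - (c - z) / δ) := by rw [hh]; field_simp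
    rw [this, norm_mul, Complex.norm_real, Real.norm_of_nonneg hδ.le]
    exact mul_le_mul_of_nonneg_left (hkη z hz) hδ.le
  have hder : ∀ z ∈ Metric.closedBall c (δ / 2), ‖deriv h z‖ ≤ 2 * η := by
    intro z hz
    have hsub : Metric.closedBall z (δ / 2) ⊆ D := fun y hy => hD <| by
      rw [Metric.mem_closedBall] at *
      linarith [dist_triangle y z c]
    have := Complex.norm_deriv_le_of_forall_mem_sphere_norm_le (f := h) (c := z) (half_pos hδ)
      ((DifferentiableOn.diffContOnCl_ball (U := Metric.closedBall z (δ / 2))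
        (fun y hy => (hdiff y (hsub hy)).differentiableWithinAt) le_rfl))
      (fun y hy => hbd y (hsub (Metric.sphere_subset_closedBall hy)))
    refine this.trans (le_of_eq ?_)
    field_simp
  have hlip : LipschitzOnWith (1 / 4) (fun z => c + h z) (Metric.closedBall c (δ / 2)) := by
    refine Convex.lipschitzOnWith_of_nnnorm_deriv_le (fun z hz => ?_) (fun z hz => ?_)
      (convex_closedBall _ _)
    · exact (differentiableAt_const _).add
        (hdiff z (hD (Metric.closedBall_subset_closedBall (by linarith) hz)))
    · rw [deriv_const_add, ← NNReal.coe_le_coe, coe_nnnorm]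
      refine (hder z hz).trans ?_
      norm_num; linarith
  have hmaps : Set.MapsTo (fun z => c + h z) (Metric.closedBall c (δ / 2))
      (Metric.closedBall c (δ / 2)) := fun z hz => by
    rw [mem_closedBall_iff_norm, add_sub_cancel_left]
    refine (hbd z (hD (Metric.closedBall_subset_closedBall (by linarith) hz))).trans ?_
    nlinarith
  have hcontr : ContractingWith (1 / 4) (hmaps.restrict _ _ _) :=
    ⟨by rw [← NNReal.coe_lt_coe]; norm_num, (hmaps.lipschitzOnWith_iff_restrict).1 hlip⟩
  obtain ⟨w, hwm, hwf, -⟩ := hcontr.exists_fixedPoint' Metric.isClosed_closedBall.isComplete hmaps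
    (x := c) (Metric.mem_closedBall_self (by linarith)) (edist_ne_top _ _)
  have hzero : ∀ z, k z = 0 ↔ c + h z = z := fun z => by
    rw [hh]
    constructor
    · intro h0; simp [h0]
    · intro h0
      have : (δ : ℂ) * k z = 0 := by linear_combination h0
      exact (mul_eq_zero.1 this).resolve_left hδ'
  refine ⟨w, mem_closedBall_iff_norm.1 hwm, (hzero w).2 hwf, fun z hz hz0 => ?_, ?_⟩
  · have hzf := (hzero z).1 hz0
    -- A zero anywhere in `D` satisfies `z - c = h z`, so it already lies in the ball where the map
    -- contracts; no geometry of `D` is needed.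
    have hzm : z ∈ Metric.closedBall c (δ / 2) := by
      rw [mem_closedBall_iff_norm, show z - c = h z by linear_combination -hzf]
      refine (hbd z hz).trans ?_
      nlinarith
    have := hlip.dist_le_mul z hzm w hwm
    simp only [show c + h z = z from hzf, show c + h w = w from hwf] at this
    have h14 : (((1 / 4 : NNReal)) : ℝ) = 1 / 4 := by norm_num
    rw [h14] at this
    exact dist_le_zero.1 (by linarith [dist_nonneg (x := z) (y := w)])
  · have hwD : w ∈ D := hD (Metric.closedBall_subset_closedBall (by linarith) hwm)
    have hdw : HasDerivAt h (δ * deriv k w + 1) w := by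
      have h1 := ((hk w hwD).hasDerivAt.const_mul (δ : ℂ)).sub ((hasDerivAt_id w).const_sub c)
      rw [sub_neg_eq_add] at h1
      exact h1
    rw [← hdw.deriv]
    exact hder w hwm

end

/-! ### Operators given by their matrices in a Hilbert basis -/

section

variable {H : Type*} [NormedAddCommGroup H] [InnerProductSpace ℂ H] {ι : Type*}

theorem hasSum_norm_inner_sq (b : HilbertBasis ι ℂ H) (x : H) :
    HasSum (fun i => ‖⟪b i, x⟫_ℂ‖ ^ 2) (‖x‖ ^ 2) := by
  have h := (b.hasSum_inner_mul_inner x x).mapL Complex.reCLM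
  simp only [Complex.reCLM_apply] at h
  convert! h using 1
  · ext i
    rw [← inner_conj_symm x (b i), Complex.conj_mul']
    norm_cast
  · rw [← RCLike.re_eq_complex_re, inner_self_eq_norm_sq]

theorem eq_of_inner_basis (b : HilbertBasis ι ℂ H) {x y : H}
    (h : ∀ i, ⟪b i, x⟫_ℂ = ⟪b i, y⟫_ℂ) : x = y := by
  refine b.repr.injective (lp.ext (funext fun i => ?_))
  rw [b.repr_apply_apply, b.repr_apply_apply, h i]

theorem inner_basis [DecidableEq ι] (b : HilbertBasis ι ℂ H) (i j : ι) :
    ⟪b i, b j⟫_ℂ = if i = j then 1 else 0 :=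
  orthonormal_iff_ite.1 b.orthonormal i j

theorem exists_vector_of_coords (b : HilbertBasis ι ℂ H) (c : ι → ℂ)
    (hc : Summable fun i => ‖c i‖ ^ 2) : ∃ x : H, ∀ i, ⟪b i, x⟫_ℂ = c i := by
  have hm : Memℓp c 2 := memℓp_gen (by simpa using hc)
  refine ⟨b.repr.symm ⟨c, hm⟩, fun i => ?_⟩
  rw [← b.repr_apply_apply, LinearIsometryEquiv.apply_symm_apply]

theorem exists_clm_of_coords (b : HilbertBasis ι ℂ H) (l : ι → H →ₗ[ℂ] ℂ) {C : ℝ} (hC : 0 ≤ C)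
    (h : ∀ x, Summable (fun i => ‖l i x‖ ^ 2) ∧ ∑' i, ‖l i x‖ ^ 2 ≤ (C * ‖x‖) ^ 2) :
    ∃ A : H →L[ℂ] H, (∀ x i, ⟪b i, A x⟫_ℂ = l i x) ∧ ‖A‖ ≤ C := by
  choose f hf using fun x => exists_vector_of_coords b (fun i => l i x) (h x).1
  let A₀ : H →ₗ[ℂ] H :=
    { toFun := f
      map_add' := fun x y => eq_of_inner_basis b fun i => by
        rw [inner_add_right, hf, hf, hf, map_add]
      map_smul' := fun c x => eq_of_inner_basis b fun i => by
        rw [inner_smul_right, hf, hf, map_smul, RingHom.id_apply, smul_eq_mul] }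
  have hA : ∀ x, ‖A₀ x‖ ≤ C * ‖x‖ := fun x => by
    refine le_of_sq_le_sq ?_ (by positivity)
    rw [← (hasSum_norm_inner_sq b (A₀ x)).tsum_eq]
    calc _ = ∑' i, ‖l i x‖ ^ 2 := tsum_congr fun i => by rw [show A₀ x = f x from rfl, hf]
      _ ≤ _ := (h x).2
  exact ⟨A₀.mkContinuous C hA, fun x i => hf x i, A₀.mkContinuous_norm_le hC hA⟩

/-- Bounded diagonal operators. -/
theorem exists_diagonal (b : HilbertBasis ι ℂ H) (c : ι → ℂ) {C : ℝ} (hC : 0 ≤ C)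
    (hc : ∀ i, ‖c i‖ ≤ C) :
    ∃ A : H →L[ℂ] H, (∀ x i, ⟪b i, A x⟫_ℂ = c i * ⟪b i, x⟫_ℂ) ∧ ‖A‖ ≤ C := by
  refine exists_clm_of_coords b (fun i => c i • (innerSL ℂ (b i)).toLinearMap) hC fun x => ?_
  have hx := (hasSum_norm_inner_sq b x).mul_left (C ^ 2)
  have hle : ∀ i, ‖(c i • (innerSL ℂ (b i)).toLinearMap) x‖ ^ 2 ≤ C ^ 2 * ‖⟪b i, x⟫_ℂ‖ ^ 2 := by
    intro i
    simp only [LinearMap.smul_apply, ContinuousLinearMap.coe_coe, innerSL_apply_apply, norm_smul,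
      mul_pow]
    gcongr
    exact hc i
  have hs := Summable.of_nonneg_of_le (fun i => by positivity) hle hx.summable
  exact ⟨hs, by rw [mul_pow, ← hx.tsum_eq]; exact hs.tsum_le_tsum hle hx.summable⟩

theorem summable_mul_norm_inner (b : HilbertBasis ι ℂ H) {p : ι → ℝ} (hp0 : ∀ i, 0 ≤ p i)
    (hp : Summable fun i => p i ^ 2) (x : H) :
    Summable (fun i => p i * ‖⟪b i, x⟫_ℂ‖) ∧
      ∑' i, p i * ‖⟪b i, x⟫_ℂ‖ ≤ √(∑' i, p i ^ 2) * ‖x‖ := by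
  have hx := hasSum_norm_inner_sq b x
  have h := Real.summable_and_inner_le_Lp_mul_Lq_tsum_of_nonneg Real.HolderConjugate.two_two
    (f := p) (g := fun i => ‖⟪b i, x⟫_ℂ‖) hp0 (fun i => norm_nonneg _)
    (by simpa using hp) (by simpa using hx.summable)
  refine ⟨h.1, h.2.trans (le_of_eq ?_)⟩
  simp only [Real.rpow_two, hx.tsum_eq, ← Real.sqrt_eq_rpow, Real.sqrt_sq (norm_nonneg x)]

/-- A matrix dominated by a rank one matrix defines a bounded operator. -/
theorem exists_matrix (b : HilbertBasis ι ℂ H) (k : ι → ι → ℂ) {p : ι → ℝ} {M : ℝ} (hM : 0 ≤ M)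
    (hp0 : ∀ i, 0 ≤ p i) (hp : Summable fun i => p i ^ 2) (hk : ∀ i j, ‖k i j‖ ≤ M * p i * p j) :
    ∃ A : H →L[ℂ] H, (∀ x i, ⟪b i, A x⟫_ℂ = ∑' j, k i j * ⟪b j, x⟫_ℂ) ∧
      (∀ x i, ‖⟪b i, A x⟫_ℂ‖ ≤ M * p i * ∑' j, p j * ‖⟪b j, x⟫_ℂ‖) ∧
      ‖A‖ ≤ M * ∑' i, p i ^ 2 := by
  have hle : ∀ x i j, ‖k i j * ⟪b j, x⟫_ℂ‖ ≤ M * p i * (p j * ‖⟪b j, x⟫_ℂ‖) := fun x i j => by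
    rw [norm_mul, ← mul_assoc]
    exact mul_le_mul_of_nonneg_right (hk i j) (norm_nonneg _)
  have hsum : ∀ x i, Summable fun j => ‖k i j * ⟪b j, x⟫_ℂ‖ := fun x i =>
    Summable.of_nonneg_of_le (fun j => norm_nonneg _) (hle x i)
      ((summable_mul_norm_inner b hp0 hp x).1.mul_left _)
  have hbd : ∀ x i, ‖∑' j, k i j * ⟪b j, x⟫_ℂ‖ ≤ M * p i * ∑' j, p j * ‖⟪b j, x⟫_ℂ‖ := fun x i => by
    refine (norm_tsum_le_tsum_norm (hsum x i)).trans ?_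
    rw [← tsum_mul_left]
    exact (hsum x i).tsum_le_tsum (hle x i) ((summable_mul_norm_inner b hp0 hp x).1.mul_left _)
  let l : ι → H →ₗ[ℂ] ℂ := fun i =>
    { toFun := fun x => ∑' j, k i j * ⟪b j, x⟫_ℂ
      map_add' := fun x y => by
        rw [← (hsum x i).of_norm.tsum_add (hsum y i).of_norm]
        exact tsum_congr fun j => by rw [inner_add_right, mul_add]
      map_smul' := fun c x => by
        rw [RingHom.id_apply, smul_eq_mul, ← tsum_mul_left]
        exact tsum_congr fun j => by rw [inner_smul_right]; ring }
  have hP : 0 ≤ ∑' i, p i ^ 2 := tsum_nonneg fun i => sq_nonneg _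
  obtain ⟨A, hA, hAn⟩ := exists_clm_of_coords b l (C := M * ∑' i, p i ^ 2) (by positivity)
    fun x => by
      have h2 := (summable_mul_norm_inner b hp0 hp x).2
      have hle2 : ∀ i, ‖l i x‖ ^ 2 ≤ (M * (√(∑' i, p i ^ 2) * ‖x‖)) ^ 2 * p i ^ 2 := fun i => by
        rw [← mul_pow]
        refine pow_le_pow_left₀ (norm_nonneg _) ((hbd x i).trans ?_) 2
        have := mul_le_mul_of_nonneg_left h2 (mul_nonneg hM (hp0 i))
        linarith
      have hs := Summable.of_nonneg_of_le (fun i => by positivity) hle2 (hp.mul_left _)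
      refine ⟨hs, (hs.tsum_le_tsum hle2 (hp.mul_left _)).trans (le_of_eq ?_)⟩
      rw [tsum_mul_left, mul_pow, mul_pow, Real.sq_sqrt hP]
      ring
  exact ⟨A, hA, fun x i => by rw [hA]; exact hbd x i, hAn⟩

end

/-! ### Reduction of a pencil to a scalar function -/

section

variable {H : Type*} [NormedAddCommGroup H] [InnerProductSpace ℂ H] {ι : Type*}

/-- For `z ∈ D` the pencil `A - z S²` is reduced to the scalar function `f` along the unit
vector `e`: `Y z` solves the equation modulo the span of `e`. -/
structure IsReducedPencil (e : H) (S A : H →L[ℂ] H) (Y : ℂ → H) (f : ℂ → ℂ) (D : Set ℂ) :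
    Prop where
  inner_Y : ∀ z ∈ D, ⟪e, Y z⟫_ℂ = 1
  apply_Y : ∀ z ∈ D, (A - z • (S * S)) (Y z) = f z • e
  eq_smul : ∀ z ∈ D, ∀ (x : H) (t : ℂ), (A - z • (S * S)) x = t • e → x = ⟪e, x⟫_ℂ • Y z
  isUnit : ∀ z ∈ D, f z ≠ 0 → IsUnit (A - z • (S * S))
  differentiableAt_Y : ∀ z ∈ D, DifferentiableAt ℂ Y z
  differentiableAt_f : ∀ z ∈ D, DifferentiableAt ℂ f z

/-- If `A - z S²` becomes invertible after replacing its `(e, e)`-entry, it can be reduced. -/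
theorem isReducedPencil_of_isUnit [CompleteSpace H] {e : H} (he : ‖e‖ = 1) (S A : H →L[ℂ] H)
    (u : ℂ → ℂ) (hu : Differentiable ℂ u) (D : Set ℂ)
    (hN : ∀ z ∈ D, IsUnit (A - z • (S * S) + (1 - u z) • (innerSL ℂ e).smulRight e))
    (hq : ∀ z ∈ D, ⟪e, Ring.inverse (A - z • (S * S) + (1 - u z) • (innerSL ℂ e).smulRight e) e⟫_ℂ
      ≠ 0) :
    IsReducedPencil e S A
      (fun z => (⟪e, Ring.inverse
          (A - z • (S * S) + (1 - u z) • (innerSL ℂ e).smulRight e) e⟫_ℂ)⁻¹ •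
        Ring.inverse (A - z • (S * S) + (1 - u z) • (innerSL ℂ e).smulRight e) e)
      (fun z => u z + ((⟪e, Ring.inverse
          (A - z • (S * S) + (1 - u z) • (innerSL ℂ e).smulRight e) e⟫_ℂ)⁻¹ - 1)) D := by
  -- `N z` differs from the pencil by a rank one term along `e`. Hence the solution of `N z x = e`,
  -- rescaled to have `e`-component one, is mapped by the pencil to a multiple of `e`; that multiple
  -- is the scalar function.
  set N : ℂ → H →L[ℂ] H := fun z => A - z • (S * S) + (1 - u z) • (innerSL ℂ e).smulRight e with hNdef
  set X : ℂ → H := fun z => Ring.inverse (N z) e with hX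
  have hNX : ∀ z ∈ D, N z (X z) = e := fun z hz => by
    rw [hX, ← mul_apply_eq_comp, Ring.mul_inverse_cancel _ (hN z hz)]; rfl
  have hXN : ∀ z ∈ D, ∀ x, Ring.inverse (N z) (N z x) = x := fun z hz x => by
    rw [← mul_apply_eq_comp, Ring.inverse_mul_cancel _ (hN z hz)]; rfl
  have hAN : ∀ z x, (A - z • (S * S)) x = N z x - ((1 - u z) * ⟪e, x⟫_ℂ) • e := fun z x => by
    simp [hNdef, mul_smul]
  have hee : ⟪e, e⟫_ℂ = 1 := by simp [inner_self_eq_norm_sq_to_K, he]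
  have hdN : ∀ z ∈ D, DifferentiableAt ℂ X z := fun z hz => by
    have h1 : DifferentiableAt ℂ N z := by
      have := hu z
      rw [hNdef]
      fun_prop
    have h2 : DifferentiableAt ℂ (fun z => Ring.inverse (N z)) z := h1.inverse (hN z hz)
    exact h2.clm_apply (differentiableAt_const e)
  have hdq : ∀ z ∈ D, DifferentiableAt ℂ (fun z => ⟪e, X z⟫_ℂ) z := fun z hz =>
    ((innerSL ℂ e).differentiableAt).comp z (hdN z hz)
  have hIY : ∀ z ∈ D, ⟪e, (⟪e, X z⟫_ℂ)⁻¹ • X z⟫_ℂ = 1 := fun z hz => by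
    rw [inner_smul_right, inv_mul_cancel₀ (hq z hz)]
  have hAY : ∀ z ∈ D, (A - z • (S * S)) ((⟪e, X z⟫_ℂ)⁻¹ • X z)
      = (u z + ((⟪e, X z⟫_ℂ)⁻¹ - 1)) • e := fun z hz => by
    rw [hAN, map_smul, hNX z hz, hIY z hz, ← sub_smul]
    congr 1; ring
  have hS : ∀ z ∈ D, ∀ (x : H) (t : ℂ), (A - z • (S * S)) x = t • e → x = ⟪e, x⟫_ℂ • (⟪e, X z⟫_ℂ)⁻¹ • X z := by
    intro z hz x t hx
    rw [hAN, sub_eq_iff_eq_add, ← add_smul] at hx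
    have h1 : x = (t + (1 - u z) * ⟪e, x⟫_ℂ) • X z := by
      conv_lhs => rw [← hXN z hz x, hx, map_smul]
    have h2 : ⟪e, x⟫_ℂ = (t + (1 - u z) * ⟪e, x⟫_ℂ) * ⟪e, X z⟫_ℂ := by
      conv_lhs => rw [h1, inner_smul_right]
    rw [smul_smul, h2, mul_assoc, mul_inv_cancel₀ (hq z hz), mul_one]
    exact h1
  refine ⟨hIY, hAY, hS, fun z hz hf => ?_, fun z hz => ?_, fun z hz => ?_⟩
  · rw [ContinuousLinearMap.isUnit_iff_bijective]
    refine ⟨(injective_iff_map_eq_zero _).2 fun x hx => ?_, fun r => ?_⟩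
    · have h1 := hS z hz x 0 (by rw [hx, zero_smul])
      rw [h1, map_smul, hAY z hz, smul_smul, smul_eq_zero] at hx
      have he0 : e ≠ 0 := by rintro rfl; simp at he
      have := (mul_eq_zero.1 (hx.resolve_right he0)).resolve_right hf
      rw [h1, this, zero_smul]
    -- The pencil maps `(N z)⁻¹ r` to `r` up to a multiple of `e`. The added multiple of `Y z`
    -- repairs this, at the price of dividing by the scalar function.
    · refine ⟨Ring.inverse (N z) r + ((1 - u z) * ⟪e, Ring.inverse (N z) r⟫_ℂ *
        (u z + ((⟪e, X z⟫_ℂ)⁻¹ - 1))⁻¹) • ((⟪e, X z⟫_ℂ)⁻¹ • X z), ?_⟩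
      rw [map_add, map_smul, hAY z hz, hAN z (Ring.inverse (N z) r), smul_smul,
        mul_assoc _ _ (u z + _), inv_mul_cancel₀ hf, mul_one,
        ← mul_apply_eq_comp, Ring.mul_inverse_cancel _ (hN z hz)]
      simp
  · exact ((hdq z hz).inv (hq z hz)).smul (hdN z hz)
  · exact (hu z).add (((hdq z hz).inv (hq z hz)).sub_const 1)

/-- The single number `g = ∑ p j |x j|` controls every coordinate: `|x i - δ_in| ≤ 2 M p i g`.
Inserting this into `g` gives `g ≤ p n + 2 (M ∑ p²) g`, so `g ≤ 2 p n`. This keeps the decay `p i *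
p n`, which a bound by the norm of `K` would lose. -/
theorem norm_sub_le_of_diag_add_matrix [DecidableEq ι] (b : HilbertBasis ι ℂ H) {n : ι}
    {p : ι → ℝ} {M : ℝ} (hM : 0 ≤ M) (hp0 : ∀ i, 0 ≤ p i) (hp : Summable fun i => p i ^ 2)
    (hMp : M * ∑' i, p i ^ 2 ≤ 1 / 64) {K : H →L[ℂ] H}
    (hK : ∀ x i, ‖⟪b i, K x⟫_ℂ‖ ≤ M * p i * ∑' j, p j * ‖⟪b j, x⟫_ℂ‖) {v : ι → ℂ}
    (hv : ∀ i, 1 / 2 ≤ ‖v i‖) (hvn : v n = 1) {x : H}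
    (hx : ∀ i, v i * ⟪b i, x⟫_ℂ + ⟪b i, K x⟫_ℂ = if i = n then 1 else 0) (i : ι) :
    ‖⟪b i, x⟫_ℂ - if i = n then 1 else 0‖ ≤ 4 * M * p i * p n := by
  set g := ∑' j, p j * ‖⟪b j, x⟫_ℂ‖ with hg
  have hg0 : 0 ≤ g := tsum_nonneg fun j => mul_nonneg (hp0 j) (norm_nonneg _)
  have h1 : ∀ i, ‖⟪b i, x⟫_ℂ - if i = n then 1 else 0‖ ≤ 2 * M * p i * g := fun i => by
    have h2 : v i * (⟪b i, x⟫_ℂ - if i = n then 1 else 0) = -⟪b i, K x⟫_ℂ := by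
      have := hx i
      split_ifs at this ⊢ with h
      · rw [h, hvn] at this ⊢; linear_combination this
      · linear_combination this
    have h3 := congrArg norm h2
    rw [norm_mul, norm_neg] at h3
    nlinarith [hv i, hK x i, norm_nonneg (⟪b i, x⟫_ℂ - if i = n then 1 else 0)]
  have hgle : g ≤ p n + 2 * (M * ∑' i, p i ^ 2) * g := by
    have hterm : ∀ i, p i * ‖⟪b i, x⟫_ℂ‖ ≤ (if i = n then p n else 0) + p i ^ 2 * (2 * M * g) := by
      intro i
      have h4 : ‖⟪b i, x⟫_ℂ‖ ≤ (if i = n then 1 else 0) + 2 * M * p i * g := by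
        have h5 := norm_sub_norm_le (⟪b i, x⟫_ℂ) (if i = n then 1 else 0)
        have h6 := h1 i
        split_ifs at h5 h6 ⊢ <;> simp at h5 h6 ⊢ <;> linarith
      have h7 := mul_le_mul_of_nonneg_left h4 (hp0 i)
      split_ifs at h7 ⊢ with h
      · rw [h] at h7 ⊢; nlinarith
      · nlinarith
    have hs1 : HasSum (fun i => if i = n then p n else 0) (p n) := hasSum_ite_eq n (p n)
    have hs2 := hs1.add (hp.hasSum.mul_right (2 * M * g))
    have := (summable_mul_norm_inner b hp0 hp x).1.tsum_le_tsum hterm hs2.summable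
    rw [hs2.tsum_eq] at this
    linarith
  have hg2 : g ≤ 2 * p n := by nlinarith
  calc _ ≤ _ := h1 i
    _ ≤ 2 * M * p i * (2 * p n) := mul_le_mul_of_nonneg_left hg2 (by have := hp0 i; positivity)
    _ = _ := by ring

/-- A Neumann series: `N - K` is diagonal with an inverse `W` of norm at most `2`, so `‖W K‖ ≤ 1 /
2`. -/
theorem isUnit_diag_add_of_norm_lt [CompleteSpace H] (b : HilbertBasis ι ℂ H) {K N : H →L[ℂ] H}
    (hK : ‖K‖ ≤ 1 / 4) {v : ι → ℂ} (hv : ∀ i, 1 / 2 ≤ ‖v i‖)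
    (hN : ∀ x i, ⟪b i, N x⟫_ℂ = v i * ⟪b i, x⟫_ℂ + ⟪b i, K x⟫_ℂ) : IsUnit N := by
  have hv0 : ∀ i, v i ≠ 0 := fun i h => by have := hv i; rw [h, norm_zero] at this; linarith
  obtain ⟨W, hW, hWn⟩ := exists_diagonal b (fun i => (v i)⁻¹) (C := 2) (by norm_num) fun i => by
    rw [norm_inv]
    exact inv_le_of_inv_le₀ (by norm_num) (by linarith [hv i])
  have h1 : (N - K) * W = 1 := by
    ext x
    refine eq_of_inner_basis b fun i => ?_
    rw [mul_apply_eq_comp, sub_apply, inner_sub_right, hN, hW,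
      ← mul_assoc, mul_inv_cancel₀ (hv0 i)]
    simp
  have h2 : W * (N - K) = 1 := by
    ext x
    refine eq_of_inner_basis b fun i => ?_
    rw [mul_apply_eq_comp, hW, sub_apply, inner_sub_right, hN,
      add_sub_cancel_right, ← mul_assoc, inv_mul_cancel₀ (hv0 i)]
    simp
  have h3 : ‖-(W * K)‖ < 1 := by
    rw [norm_neg]
    refine (norm_mul_le _ _).trans_lt ?_
    nlinarith [norm_nonneg W, norm_nonneg K]
  have h4 : N = (N - K) * (1 - -(W * K)) := by
    rw [mul_sub, mul_one, mul_neg, ← mul_assoc, h1, one_mul]; abel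
  rw [h4]
  exact IsUnit.mul ⟨⟨N - K, W, h1, h2⟩, rfl⟩ (Units.oneSub _ h3).isUnit

end

/-! ### The reduced pencil of the rescaled form perturbation -/

section

variable {H : Type*} [NormedAddCommGroup H] [InnerProductSpace ℂ H] {ι : Type*}

/-- The pencil of a form perturbation in the coordinates rescaled by `ρ`, near the `n`-th
unperturbed eigenvalue. -/
theorem exists_reducedPencil [CompleteSpace H] (b : HilbertBasis ι ℂ H) (n : ι) (μ ρ β : ι → ℝ)
    (k : ι → ι → ℂ) {M C : ℝ} (hM : 0 ≤ M) (hρ0 : ∀ i, 0 < ρ i) (hρC : ∀ i, ρ i ≤ C)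
    (hρ : ∀ i, i ≠ n → ρ i ^ 2 * |μ i - μ n| = 1) (hβ : ∀ i, 0 ≤ β i)
    (hk : ∀ i j, ‖k i j‖ ≤ M * (β i * β j)) (hs : Summable fun i => (β i * ρ i) ^ 2)
    (hMs : M * ∑' i, (β i * ρ i) ^ 2 ≤ 1 / 64) (D : Set ℂ)
    (hD : ∀ z ∈ D, ∀ i, i ≠ n → 1 / 2 ≤ ρ i ^ 2 * ‖(μ i : ℂ) - z‖) :
    ∃ (S A : H →L[ℂ] H) (Y : ℂ → H) (f : ℂ → ℂ), IsReducedPencil (b n) S A Y f D ∧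
      (∀ x i, ⟪b i, S x⟫_ℂ = ρ i * ⟪b i, x⟫_ℂ) ∧
      (∀ x i, ⟪b i, A x⟫_ℂ = μ i * (ρ i ^ 2 * ⟪b i, x⟫_ℂ)
        + ρ i * ∑' j, k i j * (ρ j * ⟪b j, x⟫_ℂ)) ∧
      (∀ z ∈ D, ‖f z - (μ n - z) * (ρ n : ℂ) ^ 2‖ ≤ 8 * M * (β n * ρ n) ^ 2) ∧
      (∀ z ∈ D, ∀ i, i ≠ n → ‖⟪b i, Y z⟫_ℂ‖ ≤ 8 * M * (β i * ρ i) * (β n * ρ n)) := by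
  classical
  have hC : 0 ≤ C := (hρ0 n).le.trans (hρC n)
  obtain ⟨S, hS, -⟩ := exists_diagonal b (fun i => (ρ i : ℂ)) hC fun i => by
    rw [Complex.norm_real, Real.norm_of_nonneg (hρ0 i).le]; exact hρC i
  obtain ⟨U, hU, -⟩ := exists_diagonal b
    (fun i => ((if i = n then 0 else (μ i - μ n) * ρ i ^ 2 : ℝ) : ℂ)) zero_le_one fun i => by
    rw [Complex.norm_real, Real.norm_eq_abs]
    split_ifs with h
    · simp
    · rw [abs_mul, abs_of_nonneg (sq_nonneg (ρ i)), mul_comm, hρ i h]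
  set p : ι → ℝ := fun i => β i * ρ i with hp
  have hp0 : ∀ i, 0 ≤ p i := fun i => mul_nonneg (hβ i) (hρ0 i).le
  obtain ⟨K, hK, hKb, hKn⟩ := exists_matrix b (fun i j => ρ i * (k i j * ρ j)) hM hp0 hs
    fun i j => by
      rw [norm_mul, norm_mul, Complex.norm_real, Complex.norm_real,
        Real.norm_of_nonneg (hρ0 i).le, Real.norm_of_nonneg (hρ0 j).le]
      have := mul_le_mul_of_nonneg_right (hk i j) (mul_nonneg (hρ0 i).le (hρ0 j).le)
      calc _ = ‖k i j‖ * (ρ i * ρ j) := by ring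
        _ ≤ _ := this
        _ = _ := by rw [hp]; ring
  -- The splitting `μ i ρ i² = (μ i - μ n) ρ i² + μ n ρ i²` makes `A` bounded although `μ` is not:
  -- the first summand has modulus one off the index `n`.
  set A : H →L[ℂ] H := U + K + (μ n : ℂ) • (S * S) with hAdef
  have hSS : ∀ x i, ⟪b i, S (S x)⟫_ℂ = (ρ i : ℂ) ^ 2 * ⟪b i, x⟫_ℂ := fun x i => by
    rw [hS, hS]; ring
  -- This is the `n`-th diagonal entry of the unperturbed pencil; trading it for `1` removes the
  -- only entry that may vanish on `D`.
  set u : ℂ → ℂ := fun z => (μ n - z) * (ρ n : ℂ) ^ 2 with hu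
  set N : ℂ → H →L[ℂ] H :=
    fun z => A - z • (S * S) + (1 - u z) • (innerSL ℂ (b n)).smulRight (b n) with hN
  set v : ℂ → ι → ℂ := fun z i => if i = n then 1 else (μ i - z) * (ρ i : ℂ) ^ 2 with hv
  have hvn : ∀ z, v z n = 1 := fun z => by simp [hv]
  have hNc : ∀ z x i, ⟪b i, N z x⟫_ℂ = v z i * ⟪b i, x⟫_ℂ + ⟪b i, K x⟫_ℂ := fun z x i => by
    have : N z x = U x + K x + (μ n : ℂ) • S (S x) - z • S (S x)
        + ((1 - u z) * ⟪b n, x⟫_ℂ) • b n := by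
      simp [hN, hAdef, mul_smul]
    rw [this]
    simp only [inner_add_right, inner_sub_right, inner_smul_right, hU, hSS, inner_basis, hv, hu]
    split_ifs with h
    · rw [h]; push_cast; ring
    · push_cast; ring
  have hvb : ∀ z ∈ D, ∀ i, 1 / 2 ≤ ‖v z i‖ := fun z hz i => by
    simp only [hv]
    split_ifs with h
    · norm_num
    · rw [norm_mul, norm_pow, Complex.norm_real, Real.norm_of_nonneg (hρ0 i).le, mul_comm]
      exact hD z hz i h
  have hunit : ∀ z ∈ D, IsUnit (N z) := fun z hz =>
    isUnit_diag_add_of_norm_lt b (by linarith) (hvb z hz) (hNc z)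
  have hX : ∀ z ∈ D, ∀ i, ‖⟪b i, Ring.inverse (N z) (b n)⟫_ℂ - if i = n then 1 else 0‖
      ≤ 4 * M * p i * p n := fun z hz i => by
    refine norm_sub_le_of_diag_add_matrix b hM hp0 hs hMs hKb (hvb z hz) (hvn z) (fun j => ?_) i
    rw [← hNc, ← mul_apply_eq_comp, Ring.mul_inverse_cancel _ (hunit z hz),
      show (1 : H →L[ℂ] H) (b n) = b n from rfl, inner_basis]
  have hpn : M * p n ^ 2 ≤ 1 / 64 :=
    (mul_le_mul_of_nonneg_left (hs.le_tsum n fun j _ => sq_nonneg _) hM).trans hMs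
  have hq1 : ∀ z ∈ D, ‖⟪b n, Ring.inverse (N z) (b n)⟫_ℂ - 1‖ ≤ 4 * M * p n ^ 2 := fun z hz => by
    have := hX z hz n
    rw [if_pos rfl] at this
    linarith
  have hqn : ∀ z ∈ D, 15 / 16 ≤ ‖⟪b n, Ring.inverse (N z) (b n)⟫_ℂ‖ := fun z hz => by
    have h1 := norm_sub_norm_le (1 : ℂ) (⟪b n, Ring.inverse (N z) (b n)⟫_ℂ)
    rw [norm_sub_rev, norm_one] at h1
    linarith [hq1 z hz]
  have hq0 : ∀ z ∈ D, ⟪b n, Ring.inverse (N z) (b n)⟫_ℂ ≠ 0 := fun z hz h => by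
    have := hqn z hz
    rw [h, norm_zero] at this
    linarith
  refine ⟨S, A, _, _, isReducedPencil_of_isUnit (b.orthonormal.1 n) S A u
    (by rw [hu]; fun_prop) D hunit hq0, hS, fun x i => ?_, fun z hz => ?_, fun z hz i hi => ?_⟩
  · have hKs : ⟪b i, K x⟫_ℂ = ρ i * ∑' j, k i j * (ρ j * ⟪b j, x⟫_ℂ) := by
      rw [hK, ← tsum_mul_left]
      exact tsum_congr fun j => by ring
    have : A x = U x + K x + (μ n : ℂ) • S (S x) := by simp [hAdef]
    rw [this]
    simp only [inner_add_right, inner_smul_right, hU, hSS, hKs]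
    have hz : ((if i = n then 0 else (μ i - μ n) * ρ i ^ 2 : ℝ) : ℂ)
        = (μ i - μ n) * (ρ i : ℂ) ^ 2 := by
      split_ifs with h
      · simp [h]
      · push_cast; ring
    rw [hz]; ring
  · change ‖u z + ((⟪b n, Ring.inverse (N z) (b n)⟫_ℂ)⁻¹ - 1) - u z‖ ≤ _
    have h1 : u z + ((⟪b n, Ring.inverse (N z) (b n)⟫_ℂ)⁻¹ - 1) - u z
        = -(⟪b n, Ring.inverse (N z) (b n)⟫_ℂ - 1) / ⟪b n, Ring.inverse (N z) (b n)⟫_ℂ := by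
      have := hq0 z hz
      field_simp
      ring
    rw [h1, norm_div, norm_neg, div_le_iff₀ (by linarith [hqn z hz])]
    have h2 : 0 ≤ M * p n ^ 2 := by positivity
    change _ ≤ 8 * M * p n ^ 2 * _
    nlinarith [hq1 z hz, hqn z hz]
  · change ‖⟪b i, (⟪b n, Ring.inverse (N z) (b n)⟫_ℂ)⁻¹ • Ring.inverse (N z) (b n)⟫_ℂ‖
      ≤ 8 * M * p i * p n
    rw [inner_smul_right, norm_mul, norm_inv, inv_mul_le_iff₀ (by linarith [hqn z hz])]
    have h1 := hX z hz i
    rw [if_neg hi, sub_zero] at h1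
    have h2 : 0 ≤ M * p i * p n := mul_nonneg (mul_nonneg hM (hp0 i)) (hp0 n)
    nlinarith [hqn z hz]

end

/-! ### Diagonal forms: energy norm, form domain, and graph in coordinates -/

section

variable {H : Type*} [NormedAddCommGroup H] [InnerProductSpace ℂ H]

/-- A closed Hermitian form that is diagonalised, with positive eigenvalues `μ`, by the Hilbert
basis `e` whose members are the `ψ i ∈ V`. -/
structure IsDiagonalForm {V : Submodule ℂ H} (a : SesqForm V) (μ : ℕ+ → ℝ)
    (e : HilbertBasis ℕ+ ℂ H) (ψ : ℕ+ → V) : Prop where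
  hermitian : IsHermitianForm a
  closed : IsClosedForm a
  nonneg : ∀ u : V, 0 ≤ (a u u).re
  coe_eq : ∀ i, (ψ i : H) = e i
  pos : ∀ i, 0 < μ i
  apply_left : ∀ i v, a (ψ i) v = μ i * ⟪(v : H), e i⟫_ℂ

namespace IsDiagonalForm

variable {V : Submodule ℂ H} {a : SesqForm V} {μ : ℕ+ → ℝ} {e : HilbertBasis ℕ+ ℂ H} {ψ : ℕ+ → V}

theorem sq_energyNorm (h : IsDiagonalForm a μ e ψ) (u : V) : energyNorm a u ^ 2 = (a u u).re :=
  Real.sq_sqrt (h.nonneg u)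

theorem norm_apply_le (h : IsDiagonalForm a μ e ψ) (u v : V) :
    ‖a u v‖ ≤ energyNorm a u * energyNorm a v := by
  let c : PreInnerProductSpace.Core ℂ V :=
    { inner := fun x y => a y x
      conj_inner_symm := fun x y => (h.hermitian y x).symm
      re_inner_nonneg := fun x => h.nonneg x
      add_left := fun x y z => map_add _ _ _
      smul_left := fun x y r => by simp }
  have := @InnerProductSpace.Core.inner_mul_inner_self_le ℂ V _ _ _ c u v
  change ‖a v u‖ * ‖a u v‖ ≤ (a u u).re * (a v v).re at this
  rw [h.hermitian v u, RCLike.norm_conj, ← h.sq_energyNorm, ← h.sq_energyNorm] at this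
  refine le_of_sq_le_sq ?_ (mul_nonneg (Real.sqrt_nonneg _) (Real.sqrt_nonneg _))
  nlinarith

theorem apply_right (h : IsDiagonalForm a μ e ψ) (u : V) (i : ℕ+) :
    a u (ψ i) = μ i * ⟪e i, (u : H)⟫_ℂ := by
  rw [h.hermitian, h.apply_left, map_mul, Complex.conj_ofReal, inner_conj_symm]

end IsDiagonalForm

theorem SesqForm.sub_comm {V : Submodule ℂ H} (a : SesqForm V) (u v : V) :
    a (u - v) (u - v) = a (v - u) (v - u) := by
  rw [← neg_sub v u]
  simp only [map_neg, LinearMap.neg_apply, neg_neg]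

/-- Partial sums of the expansion of `u`. -/
def partialSum {V : Submodule ℂ H} (e : HilbertBasis ℕ+ ℂ H) (ψ : ℕ+ → V) (F : Finset ℕ+) (u : H) :
    V :=
  ∑ i ∈ F, ⟪e i, u⟫_ℂ • ψ i

/-- An exhausting sequence of finite index sets. -/
def indexSet (k : ℕ) : Finset ℕ+ := Finset.Iic k.succPNat

theorem indexSet_mono : Monotone indexSet := fun _ _ h =>
  Finset.Iic_subset_Iic.2 (Nat.succPNat_le_succPNat.2 h)

theorem tendsto_indexSet : Filter.Tendsto indexSet Filter.atTop Filter.atTop :=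
  Filter.tendsto_atTop_finset_of_monotone indexSet_mono fun i =>
    ⟨i.natPred, Finset.mem_Iic.2 (by rw [PNat.succPNat_natPred])⟩

namespace IsDiagonalForm

variable {V : Submodule ℂ H} {a : SesqForm V} {μ : ℕ+ → ℝ} {e : HilbertBasis ℕ+ ℂ H} {ψ : ℕ+ → V}

theorem coe_partialSum (h : IsDiagonalForm a μ e ψ) (F : Finset ℕ+) (u : H) :
    (partialSum e ψ F u : H) = ∑ i ∈ F, ⟪e i, u⟫_ℂ • e i := by
  simp [partialSum, h.coe_eq]

theorem inner_partialSum (h : IsDiagonalForm a μ e ψ) (F : Finset ℕ+) (u : H) (i : ℕ+) :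
    ⟪e i, (partialSum e ψ F u : H)⟫_ℂ = if i ∈ F then ⟪e i, u⟫_ℂ else 0 := by
  classical
  rw [h.coe_partialSum, inner_sum]
  simp_rw [inner_smul_right, inner_basis]
  simp

theorem apply_partialSum_left (h : IsDiagonalForm a μ e ψ) (F : Finset ℕ+) (u : H) (v : V) :
    a (partialSum e ψ F u) v = ∑ i ∈ F, μ i * (⟪e i, u⟫_ℂ * ⟪(v : H), e i⟫_ℂ) := by
  simp only [partialSum, map_sum, map_smul, LinearMap.sum_apply, LinearMap.smul_apply, smul_eq_mul,
    h.apply_left]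
  exact Finset.sum_congr rfl fun i _ => by ring

/-- Pythagoras: the partial sum is the energy-orthogonal projection of `u` onto a span of
eigenvectors. -/
theorem apply_sub_partialSum (h : IsDiagonalForm a μ e ψ) (F : Finset ℕ+) (u : V) :
    (a (u - partialSum e ψ F u) (u - partialSum e ψ F u)).re
      = (a u u).re - ∑ i ∈ F, μ i * ‖⟪e i, (u : H)⟫_ℂ‖ ^ 2 := by
  have h1 : a (partialSum e ψ F u) u = ((∑ i ∈ F, μ i * ‖⟪e i, (u : H)⟫_ℂ‖ ^ 2 : ℝ) : ℂ) := by
    rw [h.apply_partialSum_left]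
    push_cast
    refine Finset.sum_congr rfl fun i _ => ?_
    rw [← inner_conj_symm (u : H) (e i), Complex.mul_conj']
  have h2 : a (partialSum e ψ F u) (partialSum e ψ F u)
      = ((∑ i ∈ F, μ i * ‖⟪e i, (u : H)⟫_ℂ‖ ^ 2 : ℝ) : ℂ) := by
    rw [h.apply_partialSum_left]
    push_cast
    refine Finset.sum_congr rfl fun i hi => ?_
    rw [← inner_conj_symm _ (e i), h.inner_partialSum, if_pos hi, Complex.mul_conj']
  simp only [map_sub, LinearMap.sub_apply]
  rw [h.hermitian u (partialSum e ψ F u), h1, h2, Complex.conj_ofReal]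
  simp only [Complex.sub_re, Complex.ofReal_re]
  ring

theorem apply_partialSum_sub (h : IsDiagonalForm a μ e ψ) {F G : Finset ℕ+} (hGF : G ⊆ F) (u : H) :
    (a (partialSum e ψ F u - partialSum e ψ G u) (partialSum e ψ F u - partialSum e ψ G u)).re
      = ∑ i ∈ F, μ i * ‖⟪e i, u⟫_ℂ‖ ^ 2 - ∑ i ∈ G, μ i * ‖⟪e i, u⟫_ℂ‖ ^ 2 := by
  have hG : partialSum e ψ G u = partialSum e ψ G (partialSum e ψ F u : H) := by
    refine Finset.sum_congr rfl fun i hi => ?_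
    rw [h.inner_partialSum, if_pos (hGF hi)]
  rw [hG, h.apply_sub_partialSum, h.apply_partialSum_left, Complex.re_sum]
  congr 1
  · refine Finset.sum_congr rfl fun i hi => ?_
    rw [← inner_conj_symm _ (e i), h.inner_partialSum, if_pos hi, Complex.mul_conj']
    norm_cast
  · refine Finset.sum_congr rfl fun i hi => ?_
    rw [h.inner_partialSum, if_pos (hGF hi)]

theorem tendsto_coe_partialSum (h : IsDiagonalForm a μ e ψ) (u : H) :
    Filter.Tendsto (fun k => (partialSum e ψ (indexSet k) u : H)) Filter.atTop (nhds u) := by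
  have := (e.hasSum_repr u).comp tendsto_indexSet
  refine this.congr fun k => ?_
  rw [h.coe_partialSum]
  exact Finset.sum_congr rfl fun i _ =>
    congrArg (· • e i) (e.repr_apply_apply u i)

/-- This is where closedness enters: the partial sums converge to `u` in `H` and are Cauchy in
energy. With `summable` it identifies `V` as the space of vectors with `∑ μ i |u i|² < ∞`. -/
theorem exists_mem (h : IsDiagonalForm a μ e ψ) {u : H}
    (hu : Summable fun i => μ i * ‖⟪e i, u⟫_ℂ‖ ^ 2) :
    ∃ hu : u ∈ V, Filter.Tendsto
      (fun k => (a (partialSum e ψ (indexSet k) u - ⟨u, hu⟩)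
        (partialSum e ψ (indexSet k) u - ⟨u, hu⟩)).re) Filter.atTop (nhds 0) := by
  refine h.closed _ u (h.tendsto_coe_partialSum u) fun ε hε => ?_
  have hc := (hu.hasSum.comp tendsto_indexSet).cauchySeq
  obtain ⟨K, hK⟩ := Metric.cauchySeq_iff.1 hc ε hε
  refine ⟨K, fun j k hj hk => ?_⟩
  have hd := hK j hj k hk
  rw [Real.dist_eq] at hd
  rcases le_total k j with hkj | hkj
  · rw [h.apply_partialSum_sub (indexSet_mono hkj)]
    exact (le_abs_self _).trans_lt hd
  · rw [SesqForm.sub_comm,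
      h.apply_partialSum_sub (indexSet_mono hkj)]
    rw [abs_sub_comm] at hd
    exact (le_abs_self _).trans_lt hd

theorem summable (h : IsDiagonalForm a μ e ψ) (u : V) :
    Summable fun i => μ i * ‖⟪e i, (u : H)⟫_ℂ‖ ^ 2 := by
  refine summable_of_sum_le (c := (a u u).re)
    (fun i => mul_nonneg (h.pos i).le (sq_nonneg _)) fun F => ?_
  have := h.nonneg (u - partialSum e ψ F u)
  rw [h.apply_sub_partialSum] at this
  linarith

theorem tendsto_energyNorm (h : IsDiagonalForm a μ e ψ) (u : V) :
    Filter.Tendsto (fun k => energyNorm a (partialSum e ψ (indexSet k) (u : H) - u)) Filter.atTop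
      (nhds 0) := by
  obtain ⟨_, ht⟩ := h.exists_mem (h.summable u)
  have h1 := ht.sqrt
  rw [Real.sqrt_zero] at h1
  exact h1

/-- Parseval's identity for the energy norm. -/
theorem hasSum_energyNorm_sq (h : IsDiagonalForm a μ e ψ) (u : V) :
    HasSum (fun i => μ i * ‖⟪e i, (u : H)⟫_ℂ‖ ^ 2) (energyNorm a u ^ 2) := by
  have h1 := (h.summable u).hasSum
  have h2 := h1.comp tendsto_indexSet
  have h3 : Filter.Tendsto (fun k => (a u u).re - energyNorm a
      (partialSum e ψ (indexSet k) (u : H) - u) ^ 2) Filter.atTop (nhds ((a u u).re - 0 ^ 2)) :=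
    tendsto_const_nhds.sub ((h.tendsto_energyNorm u).pow 2)
  have h4 : ∀ k, (a u u).re - energyNorm a (partialSum e ψ (indexSet k) (u : H) - u) ^ 2
      = ∑ i ∈ indexSet k, μ i * ‖⟪e i, (u : H)⟫_ℂ‖ ^ 2 := fun k => by
    rw [h.sq_energyNorm, SesqForm.sub_comm,
      h.apply_sub_partialSum]
    ring
  have h5 := tendsto_nhds_unique h2 (h3.congr h4)
  rw [h.sq_energyNorm]
  simpa [h5] using h1

/-- Only additivity of `L` is asked for, so that the linear first and the conjugate-linear second
argument of a form are both covered. -/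
theorem tendsto_apply (h : IsDiagonalForm a μ e ψ) (L : V →+ ℂ) {C : ℝ}
    (hL : ∀ v, ‖L v‖ ≤ C * energyNorm a v) (u : V) :
    Filter.Tendsto (fun k => L (partialSum e ψ (indexSet k) (u : H))) Filter.atTop
      (nhds (L u)) := by
  rw [tendsto_iff_norm_sub_tendsto_zero]
  refine squeeze_zero (fun _ => norm_nonneg _) (fun k => ?_)
    (by simpa using (h.tendsto_energyNorm u).const_mul C)
  rw [← map_sub]
  exact hL _

theorem apply_eq_tsum (h : IsDiagonalForm a μ e ψ) {b : SesqForm V}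
    (hb : IsSeparatelyContinuous a b) (u : V) (i : ℕ+)
    (hs : Summable fun j => b (ψ j) (ψ i) * ⟪e j, (u : H)⟫_ℂ) :
    b u (ψ i) = ∑' j, b (ψ j) (ψ i) * ⟪e j, (u : H)⟫_ℂ := by
  obtain ⟨C, hC⟩ := hb.1 (ψ i)
  have h1 := h.tendsto_apply (b.flip (ψ i)).toAddMonoidHom hC u
  refine tendsto_nhds_unique h1 ((hs.hasSum.comp tendsto_indexSet).congr fun k => ?_)
  simp [partialSum, mul_comm]

/-- Testing against the eigenvectors suffices: their finite combinations are dense in the energy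
norm, and both sides of `t(u, v) = (f, v)` pass to the limit along the partial sums of `v`. -/
theorem mem_formGraph_iff (h : IsDiagonalForm a μ e ψ) {b : SesqForm V}
    (hb : IsSeparatelyContinuous a b) (u f : H) :
    (u, f) ∈ formGraph (a + b) ↔ ∃ hu : u ∈ V, ∀ i,
      μ i * ⟪e i, u⟫_ℂ + b ⟨u, hu⟩ (ψ i) = ⟪e i, f⟫_ℂ := by
  constructor
  · rintro ⟨hu, hf⟩
    refine ⟨hu, fun i => ?_⟩
    have := hf (ψ i)
    rw [LinearMap.add_apply, LinearMap.add_apply, h.apply_right, h.coe_eq] at this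
    exact this
  · rintro ⟨hu, hf⟩
    refine ⟨hu, fun v => ?_⟩
    obtain ⟨C, hC⟩ := hb.2 ⟨u, hu⟩
    have h1 := h.tendsto_apply ((a + b) ⟨u, hu⟩).toAddMonoidHom
      (C := energyNorm a ⟨u, hu⟩ + C) (fun v => by
        change ‖a ⟨u, hu⟩ v + b ⟨u, hu⟩ v‖ ≤ _
        rw [add_mul]
        exact (norm_add_le _ _).trans (add_le_add (h.norm_apply_le _ _) (hC v))) v
    have h2 : Filter.Tendsto (fun k => ⟪(partialSum e ψ (indexSet k) (v : H) : H), f⟫_ℂ)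
        Filter.atTop (nhds ⟪(v : H), f⟫_ℂ) :=
      (h.tendsto_coe_partialSum (v : H)).inner tendsto_const_nhds
    refine tendsto_nhds_unique h1 (h2.congr fun k => ?_)
    rw [h.coe_partialSum, sum_inner]
    simp only [partialSum, map_sum]
    refine Finset.sum_congr rfl fun i _ => ?_
    have h3 := hf i
    change _ = (a + b) ⟨u, hu⟩ (⟪e i, (v : H)⟫_ℂ • ψ i)
    rw [inner_smul_left, LinearMap.map_smulₛₗ, LinearMap.add_apply, LinearMap.add_apply,
      h.apply_right, ← h3, smul_eq_mul]

/-- The graph of the perturbed operator in terms of a pencil of bounded operators. -/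
theorem mem_formGraph_iff_pencil (h : IsDiagonalForm a μ e ψ) {b : SesqForm V}
    (hb : IsSeparatelyContinuous a b) {ρ β : ℕ+ → ℝ} {M c C : ℝ} (hρ0 : ∀ i, 0 < ρ i)
    (hβ : ∀ i, 0 ≤ β i)
    (hc : ∀ i, 1 ≤ c * (μ i * ρ i ^ 2)) (hC : ∀ i, μ i * ρ i ^ 2 ≤ C)
    (hs : Summable fun i => (β i * ρ i) ^ 2) (hk : ∀ i j, ‖b (ψ j) (ψ i)‖ ≤ M * (β i * β j))
    {S A : H →L[ℂ] H} (hS : ∀ x i, ⟪e i, S x⟫_ℂ = ρ i * ⟪e i, x⟫_ℂ)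
    (hA : ∀ x i, ⟪e i, A x⟫_ℂ = μ i * (ρ i ^ 2 * ⟪e i, x⟫_ℂ)
        + ρ i * ∑' j, b (ψ j) (ψ i) * (ρ j * ⟪e j, x⟫_ℂ)) (z : ℂ) (u g : H) :
    (u, z • u + g) ∈ formGraph (a + b) ↔ ∃ x, u = S x ∧ (A - z • (S * S)) x = S g := by
  have hsum : ∀ x i, Summable fun j => b (ψ j) (ψ i) * ⟪e j, S x⟫_ℂ := fun x i => by
    have h1 := (summable_mul_norm_inner e (fun i => mul_nonneg (hβ i) (hρ0 i).le) hs x).1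
    refine Summable.of_norm_bounded (h1.mul_left (M * β i)) fun j => ?_
    rw [hS, norm_mul, norm_mul, Complex.norm_real, Real.norm_of_nonneg (hρ0 j).le]
    calc _ ≤ M * (β i * β j) * (ρ j * ‖⟪e j, x⟫_ℂ‖) :=
          mul_le_mul_of_nonneg_right (hk i j) (mul_nonneg (hρ0 j).le (norm_nonneg _))
      _ = _ := by ring
  have key : ∀ x (hx : S x ∈ V) i, ⟪e i, (A - z • (S * S)) x⟫_ℂ
      = ρ i * (μ i * ⟪e i, S x⟫_ℂ + b ⟨S x, hx⟩ (ψ i) - z * ⟪e i, S x⟫_ℂ) := fun x hx i => by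
    have h1 : (A - z • (S * S)) x = A x - z • S (S x) := by simp
    have h2 : b ⟨S x, hx⟩ (ψ i) = ∑' j, b (ψ j) (ψ i) * (ρ j * ⟪e j, x⟫_ℂ) := by
      rw [h.apply_eq_tsum hb ⟨S x, hx⟩ i (hsum x i)]
      exact tsum_congr fun j => by rw [hS]
    rw [h1, inner_sub_right, inner_smul_right, hA, h2, hS, hS]
    ring
  have hρ1 : ∀ i, (ρ i : ℂ) ≠ 0 := fun i => by exact_mod_cast (hρ0 i).ne'
  rw [h.mem_formGraph_iff hb]
  constructor
  · rintro ⟨hu, hf⟩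
    -- The bounds `hc` and `hC` say that `ρ⁻²` is comparable to `μ`, so `S` maps `H` onto the form
    -- domain: this direction uses `hc`, the converse `hC`.
    obtain ⟨x, hx⟩ := exists_vector_of_coords e (fun i => ⟪e i, u⟫_ℂ / ρ i) (by
      refine Summable.of_nonneg_of_le (fun i => sq_nonneg _) (fun i => ?_)
        ((h.summable ⟨u, hu⟩).mul_left c)
      have hρi := hρ0 i
      rw [norm_div, Complex.norm_real, Real.norm_of_nonneg hρi.le, div_pow, div_le_iff₀ (by positivity)]
      have := mul_le_mul_of_nonneg_right (hc i) (sq_nonneg ‖⟪e i, u⟫_ℂ‖)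
      change _ ≤ c * (μ i * ‖⟪e i, u⟫_ℂ‖ ^ 2) * ρ i ^ 2
      linarith)
    have hux : u = S x := eq_of_inner_basis e fun i => by
      rw [hS, hx, mul_div_cancel₀ _ (hρ1 i)]
    subst hux
    refine ⟨x, rfl, eq_of_inner_basis e fun i => ?_⟩
    rw [key x hu, hf i, hS g, inner_add_right, inner_smul_right, add_sub_cancel_left]
  · rintro ⟨x, rfl, hx⟩
    have hu : S x ∈ V := (h.exists_mem (by
      refine Summable.of_nonneg_of_le (fun i => mul_nonneg (h.pos i).le (sq_nonneg _)) (fun i => ?_)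
        ((hasSum_norm_inner_sq e x).summable.mul_left C)
      rw [hS, norm_mul, Complex.norm_real, Real.norm_of_nonneg (hρ0 i).le, mul_pow, ← mul_assoc]
      exact mul_le_mul_of_nonneg_right (hC i) (sq_nonneg _))).1
    refine ⟨hu, fun i => ?_⟩
    have h1 := key x hu i
    rw [hx, hS g i] at h1
    have h2 := mul_left_cancel₀ (hρ1 i) h1
    rw [inner_add_right, inner_smul_right, h2]
    ring

end IsDiagonalForm

end

/-! ### From the pencil back to the operator: resolvent, simple eigenvalue, Riesz vector -/

section

variable {H : Type*} [NormedAddCommGroup H] [InnerProductSpace ℂ H]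

theorem IsEigenpair.notMem_resolventSet {T : H →ₗ.[ℂ] H} {z : ℂ} {u : H} (h : IsEigenpair T z u) :
    z ∉ resolventSet T := by
  rintro ⟨R, -, hR⟩
  obtain ⟨v, hv, hTv⟩ := T.mem_graph_iff.1 h.2
  have := hR v
  simp only at hv hTv
  rw [hTv, hv, sub_self, map_zero] at this
  exact h.1 this.symm

/-- `T - z` is represented by the pencil `A - z S²` after the substitution `u = S x`. -/
def IsRepresented (T : H →ₗ.[ℂ] H) (S A : H →L[ℂ] H) : Prop :=
  ∀ (z : ℂ) (u g : H), (u, z • u + g) ∈ T.graph ↔ ∃ x, u = S x ∧ (A - z • (S * S)) x = S g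

/-- Solving `(T - z) u = -f` through the pencil gives `u = -S (A - z S²)⁻¹ S f`. -/
theorem IsRepresented.isResolventAt {T : H →ₗ.[ℂ] H} {S A : H →L[ℂ] H} (hT : IsRepresented T S A)
    {z : ℂ} (hz : IsUnit (A - z • (S * S))) :
    IsResolventAt T z (-(S * Ring.inverse (A - z • (S * S)) * S)) := by
  have h1 : ∀ x, (A - z • (S * S)) (Ring.inverse (A - z • (S * S)) x) = x := fun x => by
    rw [← mul_apply_eq_comp, Ring.mul_inverse_cancel _ hz]; rfl
  have h2 : ∀ x, Ring.inverse (A - z • (S * S)) ((A - z • (S * S)) x) = x := fun x => by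
    rw [← mul_apply_eq_comp, Ring.inverse_mul_cancel _ hz]; rfl
  have hR : ∀ f, (-(S * Ring.inverse (A - z • (S * S)) * S)) f
      = S (-Ring.inverse (A - z • (S * S)) (S f)) := fun f => by
    rw [map_neg]; rfl
  constructor
  · intro f
    have hg := (hT z ((-(S * Ring.inverse (A - z • (S * S)) * S)) f) (-f)).2
      ⟨_, hR f, by rw [map_neg, h1, map_neg]⟩
    obtain ⟨v, hv, hTv⟩ := T.mem_graph_iff.1 hg
    simp only at hv hTv
    refine ⟨hv ▸ v.2, ?_⟩
    have hv' : (⟨(-(S * Ring.inverse (A - z • (S * S)) * S)) f, hv ▸ v.2⟩ : T.domain) = v :=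
      Subtype.ext hv.symm
    rw [hv', hTv]
    abel
  · intro u
    have hg : ((u : H), z • (u : H) + (T u - z • (u : H))) ∈ T.graph := by
      rw [add_sub_cancel]; exact T.mem_graph u
    obtain ⟨x, hx, hNx⟩ := (hT z _ _).1 hg
    rw [hR, ← neg_sub (T u), map_neg S (T u - _), ← hNx, map_neg, map_neg, h2, map_neg, neg_neg, ← hx]

/-- Differentiating `(A - z S²) Y = f e` at the zero `w` gives `(A - w S²) Y' = f' e + S² Y`. A
longer root chain would provide `x` with `(A - w S²) x = t S² Y`. Then `x - t Y'` is mapped to `-t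
f' e`, hence is a multiple of the null vector `Y`, and `t f' = 0` forces `t = 0`. -/
theorem IsReducedPencil.isSimpleEigenpair {T : H →ₗ.[ℂ] H} {S A : H →L[ℂ] H}
    (hT : IsRepresented T S A) (hS : Function.Injective S) {e : H} {Y : ℂ → H} {f : ℂ → ℂ}
    {D : Set ℂ} (h : IsReducedPencil e S A Y f D) {w : ℂ} (hw : D ∈ nhds w) (hfw : f w = 0)
    (hf' : deriv f w ≠ 0) {c : ℂ} (hc : c ≠ 0) : IsSimpleEigenpair T w (c • S (Y w)) := by
  have hwD := mem_of_mem_nhds hw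
  have hNY : (A - w • (S * S)) (Y w) = 0 := by rw [h.apply_Y w hwD, hfw, zero_smul]
  have hY0 : Y w ≠ 0 := fun h0 => by
    have := h.inner_Y w hwD
    rw [h0, inner_zero_right] at this
    exact zero_ne_one this
  have he0 : e ≠ 0 := fun h0 => by
    have := h.inner_Y w hwD
    rw [h0, inner_zero_left] at this
    exact zero_ne_one this
  have hder : (A - w • (S * S)) (deriv Y w) = deriv f w • e + S (S (Y w)) := by
    have h1 : HasDerivAt (fun z => (A - z • (S * S)) (Y z))
        (-(S (S (Y w))) + (A - w • (S * S)) (deriv Y w)) w := by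
      have h2 : HasDerivAt (fun z : ℂ => A - z • (S * S)) (-(S * S)) w := by
        simpa using ((hasDerivAt_id w).smul_const (S * S)).const_sub A
      exact h2.clm_apply (h.differentiableAt_Y w hwD).hasDerivAt
    have h3 : HasDerivAt (fun z => (A - z • (S * S)) (Y z)) (deriv f w • e) w :=
      ((h.differentiableAt_f w hwD).hasDerivAt.smul_const e).congr_of_eventuallyEq
        (Filter.mem_of_superset hw fun z hz => h.apply_Y z hz)
    rw [← h1.unique h3]
    abel
  refine ⟨⟨smul_ne_zero hc fun h0 => hY0 (hS (by rw [h0, map_zero])), ?_⟩, fun k => ?_⟩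
  · have := (hT w (c • S (Y w)) 0).2 ⟨c • Y w, by rw [map_smul], by rw [map_smul, hNY]; simp⟩
    rwa [add_zero] at this
  · induction k with
    | zero => exact fun u hu => ⟨0, by rw [zero_smul]; exact hu⟩
    | succ k ih =>
      rintro u ⟨v, hv, hkv⟩
      obtain ⟨d, rfl⟩ := ih v hkv
      obtain ⟨x, rfl, hx⟩ := (hT w _ _).1 hv
      rw [smul_smul, map_smul] at hx
      have h4 : (A - w • (S * S)) (x - (d * c) • deriv Y w) = (-(d * c * deriv f w)) • e := by
        rw [map_sub, map_smul, hx, hder, smul_add, smul_smul, neg_smul]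
        abel
      have h5 := h.eq_smul w hwD _ _ h4
      rw [h5, map_smul, hNY, smul_zero, eq_comm, smul_eq_zero] at h4
      have h6 : d * c = 0 := by
        have := neg_eq_zero.1 (h4.resolve_right he0)
        exact (mul_eq_zero.1 this).resolve_right hf'
      rw [h6, zero_smul] at hx
      have h7 := h.eq_smul w hwD x 0 (by rw [hx, zero_smul])
      refine ⟨⟪e, x⟫_ℂ * c⁻¹, ?_⟩
      rw [smul_smul, mul_assoc, inv_mul_cancel₀ hc, mul_one]
      conv_lhs => rw [h7, map_smul]

/-- The singular points of the pencil in the rectangle are the zeros of `f`, and there is exactly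
one. Off it, `S e = ρ e` turns the resolvent into `(z - T)⁻¹ e = -(ρ / f z) S (Y z)`, whose integral
is a residue at a simple pole. -/
theorem IsReducedPencil.exists_eigenvalue [CompleteSpace H] {T : H →ₗ.[ℂ] H} {S A : H →L[ℂ] H}
    (hT : IsRepresented T S A) (hS : Function.Injective S) {e : H} {Y : ℂ → H} {f : ℂ → ℂ}
    {x₀ x₁ y₀ y₁ : ℝ} (h : IsReducedPencil e S A Y f (Set.Icc x₀ x₁ ×ℂ Set.Icc y₀ y₁))
    {ρ δ η : ℝ} {c : ℂ} (hρ : ρ ≠ 0) (hSe : S e = (ρ : ℂ) • e) (hδ : 0 < δ) (hη : η ≤ 1 / 8)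
    (hx₀ : x₀ + δ ≤ c.re) (hx₁ : c.re + δ ≤ x₁) (hy₀ : y₀ + δ ≤ c.im) (hy₁ : c.im + δ ≤ y₁)
    (hf : ∀ z ∈ Set.Icc x₀ x₁ ×ℂ Set.Icc y₀ y₁, ‖f z - (c - z) / δ‖ ≤ η) :
    ∃ w : ℂ, x₀ < w.re ∧ w.re < x₁ ∧ y₀ < w.im ∧ w.im < y₁ ∧
      (∀ z ∈ Set.Icc x₀ x₁ ×ℂ Set.Icc y₀ y₁, z ∉ resolventSet T ↔ z = w) ∧
      IsSimpleEigenpair T w ((2 * Real.pi * Complex.I : ℂ)⁻¹ •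
        rectIntegral (fun z => resolventOp T z e) x₀ x₁ y₀ y₁) ∧
      (2 * Real.pi * Complex.I : ℂ)⁻¹ • rectIntegral (fun z => resolventOp T z e) x₀ x₁ y₀ y₁
        = -((deriv f w)⁻¹ * ρ) • S (Y w) ∧ ‖δ * deriv f w + 1‖ ≤ 2 * η := by
  have hball : Metric.closedBall c δ ⊆ Set.Icc x₀ x₁ ×ℂ Set.Icc y₀ y₁ := fun z hz => by
    rw [mem_closedBall_iff_norm] at hz
    have h1 := abs_le.1 ((Complex.abs_re_le_norm (z - c)).trans hz)
    have h2 := abs_le.1 ((Complex.abs_im_le_norm (z - c)).trans hz)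
    rw [Complex.sub_re] at h1
    rw [Complex.sub_im] at h2
    exact ⟨⟨by linarith, by linarith⟩, ⟨by linarith, by linarith⟩⟩
  obtain ⟨w, hwc, hw0, hwu, hw'⟩ := exists_unique_zero hδ hη hball h.differentiableAt_f hf
  have h1 := abs_le.1 ((Complex.abs_re_le_norm (w - c)).trans hwc)
  have h2 := abs_le.1 ((Complex.abs_im_le_norm (w - c)).trans hwc)
  rw [Complex.sub_re] at h1
  rw [Complex.sub_im] at h2
  have hwx₀ : x₀ < w.re := by linarith
  have hwx₁ : w.re < x₁ := by linarith
  have hwy₀ : y₀ < w.im := by linarith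
  have hwy₁ : w.im < y₁ := by linarith
  have hf' : deriv f w ≠ 0 := fun h0 => by
    rw [h0, mul_zero, zero_add, norm_one] at hw'
    linarith
  have hres : ∀ z ∈ Set.Icc x₀ x₁ ×ℂ Set.Icc y₀ y₁, z ≠ w →
      IsUnit (A - z • (S * S)) := fun z hz hzw =>
    h.isUnit z hz fun h0 => hzw (hwu z hz h0)
  have hphi : (2 * Real.pi * Complex.I : ℂ)⁻¹ •
      rectIntegral (fun z => resolventOp T z e) x₀ x₁ y₀ y₁
        = -((deriv f w)⁻¹ * ρ) • S (Y w) := by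
    have hdY : DifferentiableOn ℂ (fun z => -(ρ : ℂ) • S (Y z))
        (Set.Icc x₀ x₁ ×ℂ Set.Icc y₀ y₁) := fun z hz =>
      (((S.differentiableAt).comp z (h.differentiableAt_Y z hz)).const_smul
        (-(ρ : ℂ))).differentiableWithinAt
    have h3 := rectIntegral_inv_smul hwx₀ hwx₁ hwy₀ hwy₁ hdY
      (fun z hz => (h.differentiableAt_f z hz).differentiableWithinAt) hw0 hf' hwu
    rw [rectIntegral_congr hwx₀ hwx₁ hwy₀ hwy₁
      (g := fun z => (f z)⁻¹ • (-(ρ : ℂ) • S (Y z))), h3, smul_smul,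
      inv_mul_cancel₀ Complex.two_pi_I_ne_zero, one_smul, smul_smul]
    · congr 1; ring
    · intro z hz hzw
      have hu := hres z hz hzw
      have hfz : f z ≠ 0 := fun h0 => hzw (hwu z hz h0)
      rw [(hT.isResolventAt hu).eq_resolventOp]
      have h4 : Ring.inverse (A - z • (S * S)) e = (f z)⁻¹ • Y z := by
        have h5 : e = (A - z • (S * S)) ((f z)⁻¹ • Y z) := by
          rw [map_smul, h.apply_Y z hz, smul_smul, inv_mul_cancel₀ hfz, one_smul]
        conv_lhs => rw [h5, ← mul_apply_eq_comp, Ring.inverse_mul_cancel _ hu]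
        rfl
      change -(S (Ring.inverse (A - z • (S * S)) (S e))) = _
      rw [hSe, map_smul, h4, map_smul, map_smul, neg_smul, smul_neg, smul_comm]
  have hsimple : IsSimpleEigenpair T w (-((deriv f w)⁻¹ * ρ) • S (Y w)) :=
    h.isSimpleEigenpair hT hS (Icc_reProdIm_mem_nhds hwx₀ hwx₁ hwy₀ hwy₁) hw0 hf'
      (neg_ne_zero.2 (mul_ne_zero (inv_ne_zero hf') (by exact_mod_cast hρ)))
  refine ⟨w, hwx₀, hwx₁, hwy₀, hwy₁, fun z hz => ⟨fun hz' => ?_, ?_⟩, hphi ▸ hsimple, hphi, hw'⟩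
  · by_contra hzw
    exact hz' ⟨_, hT.isResolventAt (hres z hz hzw)⟩
  · rintro rfl
    exact hsimple.1.notMem_resolventSet

end

/-! ### Double series with the weights of the gap condition -/

section
/-- The distance of two indices, at least one. -/
def idxDist (n m : ℕ+) : ℝ := max 1 |(m : ℝ) - n|

/-- Up to a constant, a bound for the inverse of `|μ m - μ n|` if `m ≠ n`, and of the size of the
`n`-th box if `m = n`. -/
def gapWeight (γ : ℝ) (n m : ℕ+) : ℝ := max (m : ℝ) n ^ (1 - γ) * (idxDist n m)⁻¹

theorem one_le_idxDist (n m : ℕ+) : 1 ≤ idxDist n m := le_max_left _ _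

theorem idxDist_comm (n m : ℕ+) : idxDist n m = idxDist m n := by
  rw [idxDist, idxDist, abs_sub_comm]

theorem gapWeight_comm (γ : ℝ) (n m : ℕ+) : gapWeight γ n m = gapWeight γ m n := by
  rw [gapWeight, gapWeight, idxDist_comm, max_comm]

theorem one_le_coe (n : ℕ+) : (1 : ℝ) ≤ n := by exact_mod_cast (one_le : 1 ≤ n)

theorem gapWeight_pos (γ : ℝ) (n m : ℕ+) : 0 < gapWeight γ n m :=
  mul_pos (Real.rpow_pos_of_pos (lt_max_of_lt_right (by linarith [one_le_coe n])) _)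
    (inv_pos.2 (by linarith [one_le_idxDist n m]))

theorem idxDist_le_left {n m : ℕ+} (h : m ≤ n) : idxDist n m ≤ n := by
  have h1 : (m : ℝ) ≤ n := by exact_mod_cast h
  refine max_le (one_le_coe n) ?_
  rw [abs_le]
  constructor <;> linarith [one_le_coe n, one_le_coe m]

theorem summable_rpow_neg {a : ℝ} (ha : 1 < a) : Summable fun n : ℕ+ => (n : ℝ) ^ (-a) :=
  (Real.summable_nat_rpow.2 (neg_lt_neg ha)).comp_injective PNat.coe_injective

theorem summable_max_one_abs_rpow_neg {a : ℝ} (ha : 1 < a) :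
    Summable fun j : ℤ => max 1 |(j : ℝ)| ^ (-a) := by
  have h1 : Summable fun j : ℤ => (if j = 0 then 1 else 0 : ℝ) := (hasSum_ite_eq 0 1).summable
  refine ((Real.summable_abs_int_rpow ha).add h1).of_nonneg_of_le (fun j => by positivity)
    fun j => ?_
  split_ifs with h
  · subst h
    have : (0 : ℝ) ≤ |((0 : ℤ) : ℝ)| ^ (-a) := by positivity
    simpa using this
  · have : 1 ≤ |(j : ℝ)| := by exact_mod_cast Int.one_le_abs h
    rw [max_eq_right this, add_zero]

theorem idxDist_eq (n m : ℕ+) : idxDist n m = max 1 |(((m : ℤ) - (n : ℤ) : ℤ) : ℝ)| := by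
  rw [idxDist]; push_cast; rfl

theorem summable_idxDist_rpow_neg {a : ℝ} (ha : 1 < a) (n : ℕ+) :
    Summable (fun m => idxDist n m ^ (-a)) ∧
      ∑' m, idxDist n m ^ (-a) ≤ ∑' j : ℤ, max 1 |(j : ℝ)| ^ (-a) := by
  have hi : Function.Injective fun m : ℕ+ => (m : ℤ) - (n : ℤ) := fun x y h => by
    simpa using h
  simp_rw [idxDist_eq]
  exact ⟨(summable_max_one_abs_rpow_neg ha).comp_injective hi,
    tsum_comp_le_tsum_of_inj (summable_max_one_abs_rpow_neg ha) (fun j => by positivity) hi⟩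

theorem summable_prod_rpow_neg {a b : ℝ} (ha : 1 < a) (hb : 1 < b) :
    Summable fun p : ℕ+ × ℕ+ => (p.1 : ℝ) ^ (-a) * (p.2 : ℝ) ^ (-b) :=
  (summable_rpow_neg ha).mul_of_nonneg (summable_rpow_neg hb) (fun _ => by positivity)
    fun _ => by positivity

theorem summable_prod_idxDist_rpow_neg {a b : ℝ} (ha : 1 < a) (hb : 1 < b) :
    Summable fun p : ℕ+ × ℕ+ => (p.1 : ℝ) ^ (-a) * idxDist p.1 p.2 ^ (-b) := by
  have h := (summable_rpow_neg ha).mul_of_nonneg (summable_max_one_abs_rpow_neg hb)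
    (fun _ => by positivity) fun _ => by positivity
  have hi : Function.Injective fun p : ℕ+ × ℕ+ => (p.1, (p.2 : ℤ) - (p.1 : ℤ)) := by
    rintro ⟨x, y⟩ ⟨x', y'⟩ h
    simp only [Prod.mk.injEq] at h
    obtain ⟨rfl, h2⟩ := h
    simpa using h2
  refine (h.comp_injective hi).congr fun p => ?_
  simp only [Function.comp_apply, idxDist_eq]

/-- Splitting of a product of inverses: `1 / (m (n - m)) = (1 / n) (1 / m + 1 / (n - m))`. -/
theorem inv_idxDist_eq {n m : ℕ+} (h : m < n) :
    (idxDist n m)⁻¹ = (m : ℝ) * (n : ℝ)⁻¹ * ((m : ℝ)⁻¹ + (idxDist n m)⁻¹) := by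
  have h1 : (m : ℝ) + 1 ≤ n := by exact_mod_cast h
  have hm := one_le_coe m
  have h2 : idxDist n m = n - m := by
    rw [idxDist, abs_sub_comm, abs_of_nonneg (by linarith), max_eq_right (by linarith)]
  rw [h2]
  have h3 : (n : ℝ) - m ≠ 0 := by linarith
  have h4 : (n : ℝ) ≠ 0 := by linarith
  field_simp
  ring

/-- For `m ≥ n` the power of `m` is at most `-2 r`, and it is shared between `n` and the distance,
both at most `m`. For `m < n`, partial fractions trade the inverse distance for `(m / n) (1 / m + 1
/ (n - m))`. What is left, `m^(1 - 2α) n^(-γ)`, is at most `n^(-2r)`; the two conditions on `r`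
match the two signs of `1 - 2α`. -/
theorem rpow_mul_gapWeight_le {α γ r : ℝ} (hr0 : 0 < r) (hr : 2 * r ≤ γ)
    (hr' : 2 * r ≤ 2 * α + γ - 1) (n m : ℕ+) :
    (m : ℝ) ^ (-(2 * α)) * gapWeight γ n m
      ≤ (n : ℝ) ^ (-r) * (m : ℝ) ^ (-(1 + r)) + (n : ℝ) ^ (-r) * idxDist n m ^ (-(1 + r)) := by
  have hm := one_le_coe m
  have hn := one_le_coe n
  have hJ := one_le_idxDist n m
  have hm0 : (0 : ℝ) < m := by linarith
  have hn0 : (0 : ℝ) < n := by linarith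
  have hJ0 : 0 < idxDist n m := by linarith
  have hinv : ∀ x : ℝ, 0 < x → x ^ (-(1 + r)) = x ^ (-r) * x⁻¹ := fun x hx => by
    rw [← Real.rpow_neg_one x, ← Real.rpow_add hx]; ring_nf
  rw [hinv _ hm0, hinv _ hJ0]
  rcases le_or_gt n m with h | h
  · have hnm : (n : ℝ) ≤ m := by exact_mod_cast h
    have hJm : idxDist n m ≤ m := by rw [idxDist_comm]; exact idxDist_le_left h
    rw [gapWeight, max_eq_left hnm, ← mul_assoc, ← Real.rpow_add hm0]
    have h1 : (m : ℝ) ^ (-(2 * α) + (1 - γ)) ≤ (n : ℝ) ^ (-r) * idxDist n m ^ (-r) := by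
      calc (m : ℝ) ^ (-(2 * α) + (1 - γ)) ≤ (m : ℝ) ^ (-r + -r) :=
            Real.rpow_le_rpow_of_exponent_le hm (by linarith)
        _ = (m : ℝ) ^ (-r) * (m : ℝ) ^ (-r) := Real.rpow_add hm0 _ _
        _ ≤ _ := mul_le_mul (Real.rpow_le_rpow_of_nonpos hn0 hnm (by linarith))
            (Real.rpow_le_rpow_of_nonpos hJ0 hJm (by linarith)) (by positivity) (by positivity)
    have h2 := mul_le_mul_of_nonneg_right h1 (inv_pos.2 hJ0).le
    have h3 : 0 ≤ (n : ℝ) ^ (-r) * ((m : ℝ) ^ (-r) * (m : ℝ)⁻¹) := by positivity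
    linarith
  · have hmn : (m : ℝ) ≤ n := by exact_mod_cast h.le
    have hJn : idxDist n m ≤ n := idxDist_le_left h.le
    rw [gapWeight, max_eq_right hmn]
    have h1 : (m : ℝ) ^ (-(2 * α)) * m * ((n : ℝ) ^ (1 - γ) * (n : ℝ)⁻¹)
        ≤ (n : ℝ) ^ (-r) * (n : ℝ) ^ (-r) := by
      have e1 : (m : ℝ) ^ (-(2 * α)) * m = (m : ℝ) ^ (1 - 2 * α) := by
        nth_rw 2 [← Real.rpow_one (m : ℝ)]
        rw [← Real.rpow_add hm0]; ring_nf
      have e2 : (n : ℝ) ^ (1 - γ) * (n : ℝ)⁻¹ = (n : ℝ) ^ (-γ) := by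
        rw [← Real.rpow_neg_one (n : ℝ), ← Real.rpow_add hn0]; ring_nf
      have e3 : (m : ℝ) ^ (1 - 2 * α) ≤ (n : ℝ) ^ (max 0 (1 - 2 * α)) :=
        (Real.rpow_le_rpow_of_exponent_le hm (le_max_right _ _)).trans
          (Real.rpow_le_rpow hm0.le hmn (le_max_left _ _))
      rw [e1, e2, ← Real.rpow_add hn0]
      refine (mul_le_mul_of_nonneg_right e3 (by positivity)).trans ?_
      rw [← Real.rpow_add hn0]
      refine Real.rpow_le_rpow_of_exponent_le hn ?_
      rcases max_cases 0 (1 - 2 * α) with ⟨h, -⟩ | ⟨h, -⟩ <;> rw [h] <;> linarith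
    have h2 : (n : ℝ) ^ (-r) ≤ (m : ℝ) ^ (-r) := Real.rpow_le_rpow_of_nonpos hm0 hmn (by linarith)
    have h3 : (n : ℝ) ^ (-r) ≤ idxDist n m ^ (-r) :=
      Real.rpow_le_rpow_of_nonpos hJ0 hJn (by linarith)
    have hi1 := inv_pos.2 hm0
    have hi2 := inv_pos.2 hJ0
    have hnr : 0 < (n : ℝ) ^ (-r) := by positivity
    calc _ = (m : ℝ) ^ (-(2 * α)) * m * ((n : ℝ) ^ (1 - γ) * (n : ℝ)⁻¹) *
          ((m : ℝ)⁻¹ + (idxDist n m)⁻¹) := by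
            conv_lhs => rw [inv_idxDist_eq h]
            ring
      _ ≤ (n : ℝ) ^ (-r) * (n : ℝ) ^ (-r) * ((m : ℝ)⁻¹ + (idxDist n m)⁻¹) :=
          mul_le_mul_of_nonneg_right h1 (by positivity)
      _ = (n : ℝ) ^ (-r) * ((n : ℝ) ^ (-r) * (m : ℝ)⁻¹)
          + (n : ℝ) ^ (-r) * ((n : ℝ) ^ (-r) * (idxDist n m)⁻¹) := by ring
      _ ≤ _ := by gcongr

theorem exists_tsum_gapWeight_le {α γ : ℝ} (hγ : 0 < γ) (hα : 1 < 2 * α + γ) :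
    ∃ C r : ℝ, 0 < r ∧ ∀ n : ℕ+, Summable (fun m : ℕ+ => (m : ℝ) ^ (-(2 * α)) * gapWeight γ n m) ∧
      ∑' m : ℕ+, (m : ℝ) ^ (-(2 * α)) * gapWeight γ n m ≤ C * (n : ℝ) ^ (-r) := by
  set r := min γ (2 * α + γ - 1) / 2 with hr
  have hr0 : 0 < r := half_pos (lt_min hγ (by linarith))
  have hr1 : 2 * r ≤ γ := by rw [hr]; linarith [min_le_left γ (2 * α + γ - 1)]
  have hr2 : 2 * r ≤ 2 * α + γ - 1 := by rw [hr]; linarith [min_le_right γ (2 * α + γ - 1)]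
  refine ⟨(∑' m : ℕ+, (m : ℝ) ^ (-(1 + r))) + ∑' j : ℤ, max 1 |(j : ℝ)| ^ (-(1 + r)), r, hr0,
    fun n => ?_⟩
  obtain ⟨hs1, hs2⟩ := summable_idxDist_rpow_neg (show 1 < 1 + r by linarith) n
  have hs3 := summable_rpow_neg (show 1 < 1 + r by linarith)
  have hs4 := (hs3.mul_left ((n : ℝ) ^ (-r))).add (hs1.mul_left ((n : ℝ) ^ (-r)))
  have hle := rpow_mul_gapWeight_le hr0 hr1 hr2 n
  have hs := hs4.of_nonneg_of_le (fun m => by have := gapWeight_pos γ n m; positivity) hle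
  refine ⟨hs, (hs.tsum_le_tsum hle hs4).trans ?_⟩
  rw [(hs3.mul_left _).tsum_add (hs1.mul_left _), tsum_mul_left, tsum_mul_left, ← mul_add, mul_comm]
  gcongr

theorem summable_rpow_mul_gapWeight {α γ : ℝ} (hγ : 0 < γ) (hα : 1 < 2 * α + γ) :
    Summable fun p : ℕ+ × ℕ+ =>
      (p.1 : ℝ) ^ (-(2 * α + γ)) * ((p.2 : ℝ) ^ (-(2 * α)) * gapWeight γ p.1 p.2) := by
  set r := min γ (2 * α + γ - 1) / 2 with hr
  have hr0 : 0 < r := half_pos (lt_min hγ (by linarith))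
  have hr1 : 2 * r ≤ γ := by rw [hr]; linarith [min_le_left γ (2 * α + γ - 1)]
  have hr2 : 2 * r ≤ 2 * α + γ - 1 := by rw [hr]; linarith [min_le_right γ (2 * α + γ - 1)]
  have h := (summable_prod_rpow_neg (show 1 < 2 * α + γ + r by linarith)
    (show 1 < 1 + r by linarith)).add (summable_prod_idxDist_rpow_neg
      (show 1 < 2 * α + γ + r by linarith) (show 1 < 1 + r by linarith))
  refine h.of_nonneg_of_le (fun p => by have := gapWeight_pos γ p.1 p.2; positivity) fun p => ?_
  have hn0 : (0 : ℝ) < p.1 := by linarith [one_le_coe p.1]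
  refine (mul_le_mul_of_nonneg_left (rpow_mul_gapWeight_le hr0 hr1 hr2 p.1 p.2)
    (by positivity)).trans (le_of_eq ?_)
  rw [neg_add (2 * α + γ) r, Real.rpow_add hn0]
  ring

/-- Partial fractions again, now squared: for `m < n` the remaining factor `m^(2 - 2α) n^(-2α - 2γ)`
is at most `n^(-q)`, and the two conditions on `q` match the two signs of `2 - 2α`. -/
theorem rpow_mul_gapWeight_sq_le {α γ q : ℝ} (hq : q ≤ 2 * (2 * α + γ - 1))
    (hq' : q ≤ 2 * α + 2 * γ) {n m : ℕ+} (h : m ≤ n) :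
    (n : ℝ) ^ (-(2 * α)) * (m : ℝ) ^ (-(2 * α)) * gapWeight γ n m ^ 2
      ≤ 2 * ((n : ℝ) ^ (-q) * (m : ℝ) ^ (-2 : ℝ) + (n : ℝ) ^ (-q) * idxDist n m ^ (-2 : ℝ)) := by
  have hm := one_le_coe m
  have hn := one_le_coe n
  have hJ := one_le_idxDist n m
  have hm0 : (0 : ℝ) < m := by linarith
  have hn0 : (0 : ℝ) < n := by linarith
  have hJ0 : 0 < idxDist n m := by linarith
  have hmn : (m : ℝ) ≤ n := by exact_mod_cast h
  have hinv : ∀ x : ℝ, 0 < x → x ^ (-2 : ℝ) = (x⁻¹) ^ 2 := fun x hx => by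
    rw [Real.rpow_neg hx.le, Real.rpow_two, inv_pow]
  have hsq : ∀ x y : ℝ, 0 < x → (x ^ y) ^ 2 = x ^ (2 * y) := fun x y hx => by
    rw [← Real.rpow_natCast, ← Real.rpow_mul hx.le]; congr 1; push_cast; ring
  rw [hinv _ hm0, hinv _ hJ0, gapWeight, max_eq_right hmn, mul_pow, hsq _ _ hn0]
  rcases h.eq_or_lt with rfl | h
  · have h1 : (m : ℝ) ^ (-(2 * α)) * (m : ℝ) ^ (-(2 * α)) * (m : ℝ) ^ (2 * (1 - γ))
        ≤ (m : ℝ) ^ (-q) := by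
      rw [← Real.rpow_add hm0, ← Real.rpow_add hm0]
      exact Real.rpow_le_rpow_of_exponent_le hm (by linarith)
    have h2 := mul_le_mul_of_nonneg_right h1 (sq_nonneg (idxDist m m)⁻¹)
    have h3 : 0 ≤ (m : ℝ) ^ (-q) * (m : ℝ)⁻¹ ^ 2 := by positivity
    have h4 : 0 ≤ (m : ℝ) ^ (-q) * (idxDist m m)⁻¹ ^ 2 := by positivity
    linarith
  · have h1 : (n : ℝ) ^ (-(2 * α)) * (n : ℝ) ^ (2 * (1 - γ)) * (n : ℝ)⁻¹ ^ 2 *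
        ((m : ℝ) ^ (-(2 * α)) * (m : ℝ) ^ 2) ≤ (n : ℝ) ^ (-q) := by
      have e1 : (m : ℝ) ^ (-(2 * α)) * (m : ℝ) ^ 2 = (m : ℝ) ^ (2 - 2 * α) := by
        rw [← Real.rpow_two, ← Real.rpow_add hm0]; ring_nf
      have e2 : (n : ℝ) ^ (-(2 * α)) * (n : ℝ) ^ (2 * (1 - γ)) * (n : ℝ)⁻¹ ^ 2
          = (n : ℝ) ^ (-(2 * α) - 2 * γ) := by
        rw [← hinv _ hn0, ← Real.rpow_add hn0, ← Real.rpow_add hn0]; ring_nf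
      have e3 : (m : ℝ) ^ (2 - 2 * α) ≤ (n : ℝ) ^ (max 0 (2 - 2 * α)) :=
        (Real.rpow_le_rpow_of_exponent_le hm (le_max_right _ _)).trans
          (Real.rpow_le_rpow hm0.le hmn (le_max_left _ _))
      rw [e1, e2]
      refine (mul_le_mul_of_nonneg_left e3 (by positivity)).trans ?_
      rw [← Real.rpow_add hn0]
      refine Real.rpow_le_rpow_of_exponent_le hn ?_
      rcases max_cases 0 (2 - 2 * α) with ⟨h, -⟩ | ⟨h, -⟩ <;> rw [h] <;> linarith
    have h2 : ((m : ℝ)⁻¹ + (idxDist n m)⁻¹) ^ 2 ≤ 2 * ((m : ℝ)⁻¹ ^ 2 + (idxDist n m)⁻¹ ^ 2) :=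
      add_sq_le
    calc _ = (n : ℝ) ^ (-(2 * α)) * (n : ℝ) ^ (2 * (1 - γ)) * (n : ℝ)⁻¹ ^ 2 *
          ((m : ℝ) ^ (-(2 * α)) * (m : ℝ) ^ 2) * ((m : ℝ)⁻¹ + (idxDist n m)⁻¹) ^ 2 := by
            conv_lhs => rw [inv_idxDist_eq h]
            ring
      _ ≤ (n : ℝ) ^ (-q) * (2 * ((m : ℝ)⁻¹ ^ 2 + (idxDist n m)⁻¹ ^ 2)) :=
          mul_le_mul h1 h2 (sq_nonneg _) (by positivity)
      _ = _ := by ring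

/-- The series needs an admissible `q > 1`, and `2 (2α + γ - 1) > 1` is exactly the threshold `3 /
2`. The summand is symmetric, so the bound for `m ≤ n` is used on both halves. -/
theorem summable_rpow_mul_gapWeight_sq {α γ : ℝ} (hγ : 0 < γ) (hα : 3 / 2 < 2 * α + γ) :
    Summable fun p : ℕ+ × ℕ+ =>
      (p.1 : ℝ) ^ (-(2 * α)) * (p.2 : ℝ) ^ (-(2 * α)) * gapWeight γ p.1 p.2 ^ 2 := by
  set q := min (2 * (2 * α + γ - 1)) (2 * α + 2 * γ) with hq
  have hq1 : 1 < q := lt_min (by linarith) (by linarith)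
  have h2 : (1 : ℝ) < 2 := by norm_num
  have h := (summable_prod_rpow_neg hq1 h2).add (summable_prod_idxDist_rpow_neg hq1 h2)
  refine ((h.mul_left 2).add (h.prod_symm.mul_left 2)).of_nonneg_of_le (fun p => by positivity)
    fun p => ?_
  have hp : ∀ n m : ℕ+, 0 ≤ 2 * ((n : ℝ) ^ (-q) * (m : ℝ) ^ (-2 : ℝ)
      + (n : ℝ) ^ (-q) * idxDist n m ^ (-2 : ℝ)) := fun n m => by
    have := one_le_idxDist n m
    positivity
  rcases le_total p.2 p.1 with h | h
  · exact (rpow_mul_gapWeight_sq_le (min_le_left _ _) (min_le_right _ _) h).trans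
      (le_add_of_nonneg_right (hp p.2 p.1))
  · rw [gapWeight_comm, mul_comm ((p.1 : ℝ) ^ (-(2 * α)))]
    exact (rpow_mul_gapWeight_sq_le (min_le_left _ _) (min_le_right _ _) h).trans
      (le_add_of_nonneg_left (hp p.1 p.2))

end

/-! ### Consequences of the gap condition -/

section
-- Bernoulli's inequality, based at `x` for `γ ≤ 1` and at `x + 1` for `γ ≥ 1`; in the second case
-- `x + 1 ≤ 2 x` costs the factor `2^(γ - 1)`.
theorem rpow_add_one_sub_rpow_le {γ : ℝ} (hγ : 0 < γ) :
    ∃ C : ℝ, 0 < C ∧ ∀ x : ℝ, 1 ≤ x → (x + 1) ^ γ - x ^ γ ≤ C * x ^ (γ - 1) := by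
  rcases le_total γ 1 with h | h
  · refine ⟨γ, hγ, fun x hx => ?_⟩
    have hx0 : 0 < x := by linarith
    have h1 := rpow_one_add_le_one_add_mul_self (s := x⁻¹)
      (by linarith [inv_pos.2 hx0]) hγ.le h
    have h2 : (x + 1) ^ γ = x ^ γ * (1 + x⁻¹) ^ γ := by
      rw [← Real.mul_rpow hx0.le (by positivity)]
      congr 1
      field_simp
    have h3 : x ^ (γ - 1) = x ^ γ * x⁻¹ := by rw [Real.rpow_sub_one hx0.ne', div_eq_mul_inv]
    rw [h2, h3]
    nlinarith [Real.rpow_pos_of_pos hx0 γ]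
  · refine ⟨γ * 2 ^ (γ - 1), by positivity, fun x hx => ?_⟩
    have hx0 : 0 < x := by linarith
    have hx1 : 0 < x + 1 := by linarith
    have hi : (x + 1)⁻¹ ≤ 1 := inv_le_one_of_one_le₀ (by linarith)
    have h1 := one_add_mul_self_le_rpow_one_add (s := -(x + 1)⁻¹) (by linarith) h
    have h2 : x ^ γ = (x + 1) ^ γ * (1 + -(x + 1)⁻¹) ^ γ := by
      rw [← Real.mul_rpow hx1.le (by linarith)]
      congr 1
      field_simp
      ring
    have h3 : (x + 1) ^ (γ - 1) = (x + 1) ^ γ * (x + 1)⁻¹ := by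
      rw [Real.rpow_sub_one hx1.ne', div_eq_mul_inv]
    have h4 : (x + 1) ^ (γ - 1) ≤ 2 ^ (γ - 1) * x ^ (γ - 1) := by
      rw [← Real.mul_rpow (by norm_num) hx0.le]
      exact Real.rpow_le_rpow hx1.le (by linarith) (by linarith)
    calc (x + 1) ^ γ - x ^ γ ≤ γ * (x + 1) ^ (γ - 1) := by
          rw [h2, h3]
          nlinarith [Real.rpow_pos_of_pos hx1 γ]
      _ ≤ γ * (2 ^ (γ - 1) * x ^ (γ - 1)) := mul_le_mul_of_nonneg_left h4 hγ.le
      _ = _ := by ring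

theorem mul_sub_le_rpow_sub_rpow {γ : ℝ} (hγ : 0 < γ) {x y : ℝ} (hx : 0 < x) (hxy : x ≤ y) :
    min 1 γ * ((y - x) * y ^ (γ - 1)) ≤ y ^ γ - x ^ γ := by
  have hy : 0 < y := by linarith
  have h3 : y ^ γ = y * y ^ (γ - 1) := by
    rw [Real.rpow_sub_one hy.ne']; field_simp
  have hp : 0 < y ^ (γ - 1) := by positivity
  have h0 : 0 ≤ (y - x) * y ^ (γ - 1) := mul_nonneg (by linarith) hp.le
  rcases le_total γ 1 with h | h
  · have h1 := rpow_one_add_le_one_add_mul_self (s := x / y - 1)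
      (by linarith [div_pos hx hy]) hγ.le h
    rw [add_sub_cancel, Real.div_rpow hx.le hy.le, div_le_iff₀ (by positivity)] at h1
    have h4 : (1 + γ * (x / y - 1)) * y ^ γ = y ^ γ - γ * ((y - x) * y ^ (γ - 1)) := by
      rw [h3]; field_simp; ring
    rw [min_eq_right h]
    linarith
  · have h1 : x ^ γ ≤ x * y ^ (γ - 1) := by
      have : x ^ γ = x * x ^ (γ - 1) := by rw [Real.rpow_sub_one hx.ne']; field_simp
      rw [this]
      exact mul_le_mul_of_nonneg_left (Real.rpow_le_rpow hx.le hxy (by linarith)) hx.le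
    rw [min_eq_left h, h3]
    linarith

/-- Each gap dominates a multiple of `(k + 1)^γ - k^γ`, and these increments telescope. -/
theorem exists_le_sub_of_gap {μ : ℕ+ → ℝ} {γ κ : ℝ} {N₀ : ℕ+} (hγ : 0 < γ) (hκ : 0 < κ)
    (hgap : ∀ k : ℕ+, N₀ ≤ k → κ * (k : ℝ) ^ (γ - 1) ≤ μ (k + 1) - μ k) :
    ∃ c : ℝ, 0 < c ∧ ∀ m n : ℕ+, N₀ ≤ m → m ≤ n → c * ((n : ℝ) ^ γ - (m : ℝ) ^ γ) ≤ μ n - μ m := by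
  obtain ⟨C, hC, h⟩ := rpow_add_one_sub_rpow_le hγ
  refine ⟨κ / C, div_pos hκ hC, fun m n hm => ?_⟩
  induction n using PNat.recOn with
  | one =>
    intro hmn
    rw [le_antisymm hmn one_le]
    simp
  | succ n ih =>
    intro hmn
    rcases hmn.eq_or_lt with rfl | hlt
    · simp
    · have hmn' : m ≤ n := PNat.lt_add_one_iff.1 hlt
      have h1 := ih hmn'
      have h2 := hgap n (hm.trans hmn')
      have h3 := mul_le_mul_of_nonneg_left (h n (one_le_coe n)) (div_pos hκ hC).le
      rw [← mul_assoc, div_mul_cancel₀ _ hC.ne'] at h3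
      have h4 : ((n + 1 : ℕ+) : ℝ) = (n : ℝ) + 1 := by push_cast; rfl
      rw [h4]
      linarith

theorem inv_gapWeight_of_lt (γ : ℝ) {n m : ℕ+} (h : m < n) :
    (gapWeight γ n m)⁻¹ = ((n : ℝ) - m) * (n : ℝ) ^ (γ - 1) := by
  have h1 : (m : ℝ) + 1 ≤ n := by exact_mod_cast h
  have hn := one_le_coe n
  rw [gapWeight, idxDist, max_eq_right (by linarith : (m : ℝ) ≤ n), abs_sub_comm,
    abs_of_nonneg (by linarith), max_eq_right (by linarith), mul_inv, inv_inv,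
    ← Real.rpow_neg (by linarith), neg_sub, mul_comm]

theorem gapWeight_self (γ : ℝ) (n : ℕ+) : gapWeight γ n n = (n : ℝ) ^ (1 - γ) := by
  simp [gapWeight, idxDist]

theorem exists_pos_le_of_pos {f : ℕ+ → ℝ} (hf : ∀ n, 0 < f n) {c : ℝ} (hc : 0 < c) {N : ℕ+}
    (h : ∀ n, N ≤ n → c ≤ f n) : ∃ c' : ℝ, 0 < c' ∧ ∀ n, c' ≤ f n := by
  obtain ⟨k, -, hk⟩ := (Finset.Iic N).exists_min_image f ⟨N, Finset.mem_Iic.2 le_rfl⟩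
  refine ⟨min c (f k), lt_min hc (hf k), fun n => ?_⟩
  rcases le_total N n with hn | hn
  · exact (min_le_left _ _).trans (h n hn)
  · exact (min_le_right _ _).trans (hk n (Finset.mem_Iic.2 hn))

/-- The consequences of the gap condition that hold for all large indices. -/
theorem exists_gap_estimates {μ : ℕ+ → ℝ} {γ κ : ℝ} {N₀ : ℕ+} (hμ : ∀ n, 0 < μ n) (hγ : 0 < γ)
    (hκ : 0 < κ) (hgap : ∀ k : ℕ+, N₀ ≤ k → κ * (k : ℝ) ^ (γ - 1) ≤ μ (k + 1) - μ k) :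
    ∃ c : ℝ, 0 < c ∧ (∀ n, c ≤ μ n) ∧ ∃ N : ℕ+, ∀ n : ℕ+, N ≤ n → c * (n : ℝ) ^ γ ≤ μ n ∧
      (∀ m, m < n → κ * ((n : ℝ) - 1) ^ (γ - 1) ≤ μ n - μ m) ∧
      (∀ m, n < m → κ * (n : ℝ) ^ (γ - 1) ≤ μ m - μ n) ∧
      (∀ m, m ≠ n → c * (gapWeight γ n m)⁻¹ ≤ |μ m - μ n|) ∧
      c * (n : ℝ) ^ (γ - 1) ≤ κ / 2 * ((n : ℝ) - 1) ^ (γ - 1) ∧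
      c * (n : ℝ) ^ (γ - 1) ≤ κ / 2 * (n : ℝ) ^ (γ - 1) := by
  obtain ⟨c₁, hc₁, h₁⟩ := exists_le_sub_of_gap hγ hκ hgap
  have hmono : ∀ m n : ℕ+, N₀ ≤ m → m ≤ n → μ m ≤ μ n := fun m n hm hmn => by
    have h2 : (m : ℝ) ^ γ ≤ (n : ℝ) ^ γ :=
      Real.rpow_le_rpow (by positivity) (by exact_mod_cast hmn) hγ.le
    nlinarith [h₁ m n hm hmn]
  -- The values below `N₀` need not be ordered. For large `n` they are all at most `μ n / 2`, so
  -- their distance to `μ n` is at least `c₁ n^γ / 4`.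
  obtain ⟨k, -, hk⟩ := (Finset.Iic N₀).exists_max_image μ ⟨N₀, Finset.mem_Iic.2 le_rfl⟩
  have htop : Filter.Tendsto (fun n : ℕ => c₁ / 2 * (n : ℝ) ^ γ) Filter.atTop Filter.atTop :=
    ((tendsto_rpow_atTop hγ).comp tendsto_natCast_atTop_atTop).const_mul_atTop (half_pos hc₁)
  obtain ⟨L, hL⟩ := Filter.eventually_atTop.1
    (htop.eventually_ge_atTop (max (c₁ * (N₀ : ℝ) ^ γ) (2 * μ k)))
  set N₁ : ℕ+ := max N₀ L.toPNat' with hN₁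
  have hN₁' : ∀ n, N₁ ≤ n → c₁ / 2 * (n : ℝ) ^ γ ≤ μ n ∧ 2 * μ k ≤ μ n := fun n hn => by
    have hLn : L ≤ n := by
      have h2 : L.toPNat' ≤ n := (le_max_right _ _).trans hn
      have h3 : (L.toPNat' : ℕ) ≤ n := h2
      rcases Nat.eq_zero_or_pos L with h0 | h0
      · omega
      · rwa [Nat.toPNat'_coe, if_pos h0] at h3
    have h4 := hL n hLn
    have h5 := h₁ N₀ n le_rfl ((le_max_left _ _).trans hn)
    have h6 := hμ N₀
    have h7 := (le_max_left _ _).trans h4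
    have h8 := (le_max_right _ _).trans h4
    constructor <;> nlinarith
  have h2pos : 0 < min 1 ((1 / 2 : ℝ) ^ (γ - 1)) := lt_min one_pos (by positivity)
  have hx1 := mul_pos (lt_min one_pos hγ) hc₁
  obtain ⟨c₂, hc₂, h₂⟩ := exists_pos_le_of_pos hμ (mul_pos (half_pos hc₁) one_pos)
    (N := N₁) fun n hn => (mul_le_mul_of_nonneg_left (Real.one_le_rpow (one_le_coe n) hγ.le)
      (half_pos hc₁).le).trans (hN₁' n hn).1
  -- The four bounds serve, in order: `μ` from below, distances to indices below `N₀`, distances to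
  -- the other indices, and the half-widths of the box, where `n - 1 ≥ n / 2` gives the power of `1
  -- / 2`.
  obtain ⟨c, hc, hcle⟩ : ∃ c : ℝ, 0 < c ∧ c ≤ c₂ ∧ c ≤ c₁ / 4 ∧ c ≤ min 1 γ * c₁ ∧
      c ≤ κ / 2 * min 1 ((1 / 2 : ℝ) ^ (γ - 1)) :=
    ⟨min c₂ (min (c₁ / 4) (min (min 1 γ * c₁) (κ / 2 * min 1 ((1 / 2 : ℝ) ^ (γ - 1))))),
      by positivity, by simp⟩
  obtain ⟨hcc₂, hcc₁, hcγ, hcκ⟩ := hcle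
  -- The shift by one makes the estimates available at the predecessor `n'`, whose gap bounds the
  -- distance from `μ n` to lower values.
  refine ⟨c, hc, fun n => hcc₂.trans (h₂ n), N₁ + 1, fun n hn => ?_⟩
  have hnN₁ : N₁ ≤ n := (PNat.lt_add_right N₁ 1).le.trans hn
  have hN₀n : N₀ ≤ n := (le_max_left _ _).trans hnN₁
  have hn0 : (0 : ℝ) < n := by linarith [one_le_coe n]
  obtain ⟨n', rfl⟩ : ∃ n', n = n' + 1 :=
    PNat.exists_eq_succ_of_ne_one (ne_of_gt (lt_of_lt_of_le (PNat.lt_add_left 1 N₁) hn))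
  have hn' : N₁ ≤ n' := by simpa using hn
  have hN₀n' : N₀ ≤ n' := (le_max_left _ _).trans hn'
  have hcast : ((n' + 1 : ℕ+) : ℝ) = (n' : ℝ) + 1 := by push_cast; rfl
  have hpos' := one_le_coe n'
  have hlow : ∀ m, m < N₀ → 2 * μ m ≤ μ n' ∧ 2 * μ m ≤ μ (n' + 1) := fun m hm => by
    have h3 := hk m (Finset.mem_Iic.2 hm.le)
    exact ⟨by linarith [(hN₁' n' hn').2], by linarith [(hN₁' _ hnN₁).2]⟩
  have hgapm : ∀ m n : ℕ+, N₀ ≤ m → m < n → c * (gapWeight γ n m)⁻¹ ≤ μ n - μ m := by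
    intro m n hm hmn
    rw [inv_gapWeight_of_lt γ hmn]
    have hmn' : (m : ℝ) ≤ n := by exact_mod_cast hmn.le
    have hm1 := one_le_coe m
    have h3 := mul_sub_le_rpow_sub_rpow hγ (x := m) (y := n) (by linarith) hmn'
    have h4 : 0 ≤ ((n : ℝ) - m) * (n : ℝ) ^ (γ - 1) := mul_nonneg (by linarith) (by positivity)
    calc _ ≤ min 1 γ * c₁ * (((n : ℝ) - m) * (n : ℝ) ^ (γ - 1)) :=
          mul_le_mul_of_nonneg_right hcγ h4
      _ = c₁ * (min 1 γ * (((n : ℝ) - m) * (n : ℝ) ^ (γ - 1))) := by ring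
      _ ≤ c₁ * ((n : ℝ) ^ γ - (m : ℝ) ^ γ) := mul_le_mul_of_nonneg_left h3 hc₁.le
      _ ≤ _ := h₁ m n hm hmn.le
  have hnγ : 0 < ((n' + 1 : ℕ+) : ℝ) ^ γ := by positivity
  have hnγ1 : 0 < ((n' + 1 : ℕ+) : ℝ) ^ (γ - 1) := by positivity
  refine ⟨?_, fun m hm => ?_, fun m hm => ?_, fun m hm => ?_, ?_, ?_⟩
  · nlinarith [(hN₁' _ hnN₁).1]
  · have h3 := hgap n' hN₀n'
    have h4 : μ m ≤ μ n' := by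
      rcases lt_or_ge m N₀ with h | h
      · linarith [(hlow m h).1, hμ m]
      · exact hmono m n' h (PNat.lt_add_one_iff.1 hm)
    rw [hcast, add_sub_cancel_right]
    linarith
  · have h3 := hgap _ hN₀n
    have h4 := hmono (n' + 1 + 1) m (hN₀n.trans (PNat.lt_add_right _ 1).le)
      (PNat.add_one_le_iff.2 hm)
    linarith
  · rcases hm.lt_or_gt with h | h
    · rw [abs_sub_comm]
      refine le_trans ?_ (le_abs_self _)
      rcases lt_or_ge m N₀ with h0 | h0
      · rw [inv_gapWeight_of_lt γ h]
        have h3 : (((n' + 1 : ℕ+) : ℝ) - m) * ((n' + 1 : ℕ+) : ℝ) ^ (γ - 1)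
            ≤ ((n' + 1 : ℕ+) : ℝ) ^ γ := by
          have : ((n' + 1 : ℕ+) : ℝ) ^ γ
              = ((n' + 1 : ℕ+) : ℝ) * ((n' + 1 : ℕ+) : ℝ) ^ (γ - 1) := by
            rw [Real.rpow_sub_one hn0.ne']; field_simp
          rw [this]
          exact mul_le_mul_of_nonneg_right (by linarith [one_le_coe m]) hnγ1.le
        have h5 := (hN₁' _ hnN₁).1
        have h6 := (hlow m h0).2
        nlinarith
      · exact hgapm m _ h0 h
    · refine le_trans ?_ (le_abs_self _)
      rw [gapWeight_comm]
      exact hgapm _ m hN₀n h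
  · have h3 : min 1 ((1 / 2 : ℝ) ^ (γ - 1)) * ((n' + 1 : ℕ+) : ℝ) ^ (γ - 1)
        ≤ (((n' + 1 : ℕ+) : ℝ) - 1) ^ (γ - 1) := by
      rw [hcast, add_sub_cancel_right]
      rcases le_total γ 1 with h | h
      · refine (mul_le_of_le_one_left (by positivity) (min_le_left _ _)).trans ?_
        exact Real.rpow_le_rpow_of_nonpos (by linarith) (by linarith) (by linarith)
      · refine (mul_le_mul_of_nonneg_right (min_le_right _ _) (by positivity)).trans ?_
        rw [← Real.mul_rpow (by norm_num) (by linarith)]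
        exact Real.rpow_le_rpow (by linarith) (by linarith) (by linarith)
    calc _ ≤ κ / 2 * min 1 ((1 / 2 : ℝ) ^ (γ - 1)) * ((n' + 1 : ℕ+) : ℝ) ^ (γ - 1) :=
          mul_le_mul_of_nonneg_right hcκ hnγ1.le
      _ = κ / 2 * (min 1 ((1 / 2 : ℝ) ^ (γ - 1)) * ((n' + 1 : ℕ+) : ℝ) ^ (γ - 1)) := by ring
      _ ≤ _ := mul_le_mul_of_nonneg_left h3 (half_pos hκ).le
  · refine mul_le_mul_of_nonneg_right (hcκ.trans ?_) hnγ1.le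
    exact mul_le_of_le_one_right (half_pos hκ).le (min_le_left _ _)

end

/-! ### Localisation of one eigenvalue, and quadratic closeness -/

section

variable {H : Type*} [NormedAddCommGroup H] [InnerProductSpace ℂ H]

/-- The inverse distance of `μ m` to `μ n`, with `δ⁻¹` on the diagonal. -/
def invGap (μ : ℕ+ → ℝ) (δ : ℝ) (n m : ℕ+) : ℝ := if m = n then δ⁻¹ else |μ m - μ n|⁻¹

theorem IsDiagonalForm.exists_eigenvalue_near [CompleteSpace H] {V : Submodule ℂ H}
    (hV : Dense (V : Set H)) {a b : SesqForm V} {μ : ℕ+ → ℝ} {e : HilbertBasis ℕ+ ℂ H}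
    {ψ : ℕ+ → V} (h : IsDiagonalForm a μ e ψ) (hb : IsSeparatelyContinuous a b) {β : ℕ+ → ℝ}
    {M : ℝ} (hM : 0 ≤ M) (hβ : ∀ i, 0 ≤ β i)
    (hk : ∀ i j, ‖b (ψ j) (ψ i)‖ ≤ M * (β i * β j)) {μ₀ : ℝ} (hμ₀ : 0 < μ₀) (hμ : ∀ i, μ₀ ≤ μ i)
    (n : ℕ+) {l r δ : ℝ} (hδ : 0 < δ) (hδl : δ ≤ l) (hδr : δ ≤ r)
    (hl : ∀ m, m < n → 2 * l ≤ μ n - μ m) (hr : ∀ m, n < m → 2 * r ≤ μ m - μ n)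
    (hs : Summable fun m => β m ^ 2 * invGap μ δ n m)
    (hMs : M * ∑' m, β m ^ 2 * invGap μ δ n m ≤ 1 / 64) :
    ∃ w : ℂ, μ n - l < w.re ∧ w.re < μ n + r ∧ -r < w.im ∧ w.im < r ∧
      (∀ z ∈ Set.Icc (μ n - l) (μ n + r) ×ℂ Set.Icc (-r) r,
        z ∉ resolventSet (formOperator (a + b)) ↔ z = w) ∧
      IsSimpleEigenpair (formOperator (a + b)) w ((2 * Real.pi * Complex.I : ℂ)⁻¹ •
        rectIntegral (fun z => resolventOp (formOperator (a + b)) z (e n))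
          (μ n - l) (μ n + r) (-r) r) ∧
      ∀ m, ‖⟪e m, (2 * Real.pi * Complex.I : ℂ)⁻¹ •
        rectIntegral (fun z => resolventOp (formOperator (a + b)) z (e n))
          (μ n - l) (μ n + r) (-r) r - e n⟫_ℂ‖ ≤ 32 * M * (β m * β n) * invGap μ δ n m := by
  classical
  have hd : ∀ m, m ≠ n → 2 * δ ≤ |μ m - μ n| := fun m hm => by
    rcases hm.lt_or_gt with h1 | h1
    · rw [abs_sub_comm]
      exact le_trans (by linarith [hl m h1]) (le_abs_self _)
    · exact le_trans (by linarith [hr m h1]) (le_abs_self _)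
  have hω0 : ∀ m, 0 < invGap μ δ n m := fun m => by
    rw [invGap]
    split_ifs with hm
    · exact inv_pos.2 hδ
    · exact inv_pos.2 (by linarith [hd m hm])
  have hωδ : ∀ m, invGap μ δ n m ≤ δ⁻¹ := fun m => by
    rw [invGap]
    split_ifs with hm
    · exact le_rfl
    · exact inv_anti₀ hδ (by linarith [hd m hm])
  set ρ : ℕ+ → ℝ := fun m => √(invGap μ δ n m) with hρdef
  have hρ0 : ∀ m, 0 < ρ m := fun m => Real.sqrt_pos.2 (hω0 m)
  have hρ2 : ∀ m, ρ m ^ 2 = invGap μ δ n m := fun m => Real.sq_sqrt (hω0 m).le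
  have hρn : ρ n ^ 2 = δ⁻¹ := by rw [hρ2, invGap, if_pos rfl]
  have hρn' : (ρ n : ℂ) ^ 2 = (δ : ℂ)⁻¹ := by exact_mod_cast hρn
  have hρm : ∀ m, m ≠ n → ρ m ^ 2 = |μ m - μ n|⁻¹ := fun m hm => by rw [hρ2, invGap, if_neg hm]
  have hμn := hμ₀.trans_le (hμ n)
  have hs' : Summable fun m => (β m * ρ m) ^ 2 := hs.congr fun m => by rw [mul_pow, hρ2]
  have hMs' : M * ∑' m, (β m * ρ m) ^ 2 ≤ 1 / 64 := by
    simp_rw [mul_pow, hρ2]; exact hMs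
  obtain ⟨S, A, Y, f, hP, hS, hA, hf, hY⟩ := exists_reducedPencil e n μ ρ β
    (fun i j => b (ψ j) (ψ i)) hM hρ0 (fun m => Real.sqrt_le_sqrt (hωδ m))
    (fun m hm => by
      rw [hρm m hm, inv_mul_cancel₀]
      linarith [hd m hm])
    hβ hk hs' hMs' (Set.Icc (μ n - l) (μ n + r) ×ℂ Set.Icc (-r) r) (fun z hz m hm => by
      have hdm := hd m hm
      have h1 : |μ m - μ n| / 2 ≤ ‖(μ m : ℂ) - z‖ := by
        refine le_trans ?_ (Complex.abs_re_le_norm _)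
        rw [Complex.sub_re, Complex.ofReal_re]
        have hz1 := hz.1.1
        have hz2 := hz.1.2
        rcases hm.lt_or_gt with h2 | h2
        · have := hl m h2
          rw [abs_sub_comm, abs_of_nonneg (by linarith), abs_sub_comm]
          exact le_trans (by linarith) (le_abs_self _)
        · have := hr m h2
          rw [abs_of_nonneg (by linarith)]
          exact le_trans (by linarith) (le_abs_self _)
      rw [hρm m hm, le_inv_mul_iff₀ (by linarith)]
      linarith)
  have hrep : IsRepresented (formOperator (a + b)) S A := fun z u g => by
    rw [formOperator_graph hV]
    -- Off the diagonal `ρ m⁻² = |μ m - μ n| ≥ δ` differs from `μ m` by at most `μ n`, and `μ n ≤ (μ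
    -- n / μ₀) μ m`. The terms with `δ` also cover `m = n`.
    refine h.mem_formGraph_iff_pencil hb (ρ := ρ) (β := β) (c := 1 + μ n / μ₀ + δ / μ₀)
      (C := 1 + μ n / δ) hρ0 hβ (fun m => ?_) (fun m => ?_) hs' hk hS hA z u g
    · have hm0 := hμ₀.trans_le (hμ m)
      have h1 : 1 ≤ μ m / μ₀ := (one_le_div hμ₀).2 (hμ m)
      have h2 : (1 + μ n / μ₀ + δ / μ₀) * μ m = μ m + μ n * (μ m / μ₀) + δ * (μ m / μ₀) := by
        field_simp
      rw [← mul_assoc, h2]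
      by_cases hm : m = n
      · rw [hm, hρn, ← div_eq_mul_inv, le_div_iff₀ hδ, ← hm]
        nlinarith
      · have h3 := hd m hm
        rw [hρm m hm, ← div_eq_mul_inv, le_div_iff₀ (by linarith), one_mul, abs_le]
        constructor <;> nlinarith
    · by_cases hm : m = n
      · rw [hm, hρn, ← div_eq_mul_inv]; linarith
      · have h3 := hd m hm
        rw [hρm m hm, ← div_eq_mul_inv, div_le_iff₀ (by linarith), add_mul, one_mul]
        have h4 : μ n ≤ μ n / δ * |μ m - μ n| := by
          rw [div_mul_eq_mul_div, le_div_iff₀ hδ]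
          nlinarith
        linarith [le_abs_self (μ m - μ n)]
  have hSinj : Function.Injective S := fun x y hxy => eq_of_inner_basis e fun i => by
    have h1 : (ρ i : ℂ) ≠ 0 := by exact_mod_cast (hρ0 i).ne'
    refine mul_left_cancel₀ h1 ?_
    rw [← hS, ← hS, hxy]
  have hSe : S (e n) = (ρ n : ℂ) • e n := eq_of_inner_basis e fun i => by
    rw [hS, inner_smul_right, inner_basis]
    split_ifs with hi
    · rw [hi]
    · simp
  have hMn : M * (β n * ρ n) ^ 2 ≤ 1 / 64 :=
    (mul_le_mul_of_nonneg_left (hs'.le_tsum n fun j _ => sq_nonneg _) hM).trans hMs'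
  obtain ⟨w, hw1, hw2, hw3, hw4, hwr, hws, hwφ, hwd⟩ := hP.exists_eigenvalue hrep hSinj
    (η := 8 * M * (β n * ρ n) ^ 2) (c := (μ n : ℂ)) (hρ0 n).ne' hSe hδ (by linarith)
    (by rw [Complex.ofReal_re]; linarith) (by rw [Complex.ofReal_re]; linarith)
    (by rw [Complex.ofReal_im]; linarith) (by rw [Complex.ofReal_im]; linarith)
    (fun z hz => by
      have := hf z hz
      rwa [hρn', ← div_eq_mul_inv] at this)
  have hwD : w ∈ Set.Icc (μ n - l) (μ n + r) ×ℂ Set.Icc (-r) r :=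
    ⟨⟨hw1.le, hw2.le⟩, ⟨hw3.le, hw4.le⟩⟩
  refine ⟨w, hw1, hw2, hw3, hw4, hwr, hws, fun m => ?_⟩
  rw [hwφ, inner_sub_right, inner_smul_right, hS, inner_basis, ← hρ2]
  have hδ' : (δ : ℂ) ≠ 0 := by exact_mod_cast hδ.ne'
  -- Since `f` is close to `(μ n - z) / δ`, the product `δ f'` is within `2 η ≤ 1 / 4` of `-1`. The
  -- coordinate at `m = n` is `-1 / (δ f') - 1`, small for the same reason.
  have ht : 3 / 4 ≤ ‖(δ : ℂ) * deriv f w‖ := by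
    have h1 := norm_sub_norm_le (1 : ℂ) (1 + δ * deriv f w)
    rw [norm_one, sub_add_cancel_left, norm_neg, add_comm (1 : ℂ)] at h1
    linarith
  have ht0 : (δ : ℂ) * deriv f w ≠ 0 := fun h0 => by rw [h0, norm_zero] at ht; linarith
  have hf0 : deriv f w ≠ 0 := right_ne_zero_of_mul ht0
  have hpos : 0 ≤ M * (β m * β n) * ρ m ^ 2 := by
    have := hβ m; have := hβ n; positivity
  by_cases hm : m = n
  · subst hm
    rw [if_pos rfl, hP.inner_Y w hwD]
    have h2 : -((deriv f w)⁻¹ * (ρ m : ℂ)) * (ρ m * 1) - 1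
        = -(δ * deriv f w + 1) / (δ * deriv f w) := by
      have : -((deriv f w)⁻¹ * (ρ m : ℂ)) * (ρ m * 1) = -(deriv f w)⁻¹ * (ρ m : ℂ) ^ 2 := by ring
      rw [this, hρn']
      field_simp
      ring
    rw [h2, norm_div, norm_neg, div_le_iff₀ (by linarith)]
    have h3 : 16 * (M * (β m * β m) * ρ m ^ 2) ≤ 32 * M * (β m * β m) * ρ m ^ 2 * (3 / 4) := by
      linarith
    have h4 := mul_le_mul_of_nonneg_left ht (show 0 ≤ 32 * M * (β m * β m) * ρ m ^ 2 by linarith)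
    refine le_trans ?_ h4
    refine le_trans hwd (le_trans (le_of_eq ?_) h3)
    ring
  · rw [if_neg hm, sub_zero, norm_mul, norm_mul, norm_neg, norm_mul, Complex.norm_real,
      Complex.norm_real, Real.norm_of_nonneg (hρ0 n).le, Real.norm_of_nonneg (hρ0 m).le, norm_inv]
    have h1 := hY w hwD m hm
    have h2 : ‖deriv f w‖⁻¹ ≤ 4 / 3 * δ := by
      rw [norm_mul, Complex.norm_real, Real.norm_of_nonneg hδ.le] at ht
      refine inv_le_of_inv_le₀ (by positivity) ?_
      rw [mul_inv, inv_mul_le_iff₀ (by norm_num), inv_le_iff_one_le_mul₀ hδ]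
      linarith
    calc ‖deriv f w‖⁻¹ * ρ n * (ρ m * ‖⟪e m, Y w⟫_ℂ‖)
        ≤ 4 / 3 * δ * ρ n * (ρ m * (8 * M * (β m * ρ m) * (β n * ρ n))) := by
          have := hρ0 m; have := hρ0 n; gcongr
      _ = 32 / 3 * (M * (β m * β n) * ρ m ^ 2) * (δ * ρ n ^ 2) := by ring
      _ = 32 / 3 * (M * (β m * β n) * ρ m ^ 2) := by rw [hρn, mul_inv_cancel₀ hδ.ne', mul_one]
      _ ≤ _ := by linarith

theorem invGap_le {μ : ℕ+ → ℝ} {γ c : ℝ} (hc : 0 < c) {n : ℕ+}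
    (h : ∀ m, m ≠ n → c * (gapWeight γ n m)⁻¹ ≤ |μ m - μ n|) (m : ℕ+) :
    invGap μ (c * (n : ℝ) ^ (γ - 1)) n m ≤ c⁻¹ * gapWeight γ n m := by
  rw [invGap]
  split_ifs with hm
  · have hn := one_le_coe n
    rw [hm, gapWeight_self, mul_inv, ← Real.rpow_neg (by linarith), neg_sub]
  · have h1 := inv_anti₀ (mul_pos hc (inv_pos.2 (gapWeight_pos γ n m))) (h m hm)
    rwa [mul_inv, inv_inv] at h1

theorem invGap_pos {μ : ℕ+ → ℝ} {γ c : ℝ} (hc : 0 < c) {n : ℕ+}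
    (h : ∀ m, m ≠ n → c * (gapWeight γ n m)⁻¹ ≤ |μ m - μ n|) (m : ℕ+) :
    0 < invGap μ (c * (n : ℝ) ^ (γ - 1)) n m := by
  rw [invGap]
  split_ifs with hm
  · have hn := one_le_coe n
    positivity
  · exact inv_pos.2 ((mul_pos hc (inv_pos.2 (gapWeight_pos γ n m))).trans_le (h m hm))

/-- The energy weight obeys `μ m / μ n ≤ 1 + |μ m - μ n| / μ n`; the second term cancels one of the
two inverse gaps and gains `n^(-γ)` from `1 / μ n`. -/
theorem div_mul_invGap_sq_le {μ : ℕ+ → ℝ} {γ c : ℝ} (hc : 0 < c) {n : ℕ+} (hμ : ∀ m, 0 < μ m)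
    (hn : c * (n : ℝ) ^ γ ≤ μ n)
    (h : ∀ m, m ≠ n → c * (gapWeight γ n m)⁻¹ ≤ |μ m - μ n|) (m : ℕ+) :
    μ m / μ n * invGap μ (c * (n : ℝ) ^ (γ - 1)) n m ^ 2
      ≤ (c⁻¹) ^ 2 * (gapWeight γ n m ^ 2 + (n : ℝ) ^ (-γ) * gapWeight γ n m) := by
  have hω := invGap_le hc h m
  have hω0 := invGap_pos hc h m
  have hw := gapWeight_pos γ n m
  have hn1 := one_le_coe n
  have hnγ : 0 < (n : ℝ) ^ (-γ) := by positivity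
  have hsq : invGap μ (c * (n : ℝ) ^ (γ - 1)) n m ^ 2 ≤ (c⁻¹) ^ 2 * gapWeight γ n m ^ 2 := by
    rw [← mul_pow]
    exact pow_le_pow_left₀ hω0.le hω 2
  have hrest : 0 ≤ (c⁻¹) ^ 2 * ((n : ℝ) ^ (-γ) * gapWeight γ n m) := by positivity
  by_cases hm : m = n
  · have h1 : μ m / μ n = 1 := by rw [hm, div_self (hμ n).ne']
    rw [h1, one_mul]
    linarith
  · set d := |μ m - μ n| with hd
    have hd0 : 0 < d := (mul_pos hc (inv_pos.2 hw)).trans_le (h m hm)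
    have hωd : invGap μ (c * (n : ℝ) ^ (γ - 1)) n m = d⁻¹ := by rw [invGap, if_neg hm]
    have h1 : μ m / μ n ≤ 1 + d * (μ n)⁻¹ := by
      rw [div_le_iff₀ (hμ n), add_mul, mul_assoc, inv_mul_cancel₀ (hμ n).ne']
      linarith [le_abs_self (μ m - μ n)]
    have h2 : (μ n)⁻¹ ≤ c⁻¹ * (n : ℝ) ^ (-γ) := by
      rw [Real.rpow_neg (by linarith), ← mul_inv]
      exact inv_anti₀ (by positivity) hn
    calc _ ≤ (1 + d * (μ n)⁻¹) * invGap μ (c * (n : ℝ) ^ (γ - 1)) n m ^ 2 :=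
          mul_le_mul_of_nonneg_right h1 (sq_nonneg _)
      _ = invGap μ (c * (n : ℝ) ^ (γ - 1)) n m ^ 2
          + (μ n)⁻¹ * invGap μ (c * (n : ℝ) ^ (γ - 1)) n m := by
            rw [hωd]; field_simp
      _ ≤ (c⁻¹) ^ 2 * gapWeight γ n m ^ 2 + c⁻¹ * (n : ℝ) ^ (-γ) * (c⁻¹ * gapWeight γ n m) :=
          add_le_add hsq (mul_le_mul h2 hω hω0.le (by positivity))
      _ = _ := by ring

theorem IsDiagonalForm.summable_energyNorm_sq {V : Submodule ℂ H} {a : SesqForm V} {μ : ℕ+ → ℝ}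
    {e : HilbertBasis ℕ+ ℂ H} {ψ : ℕ+ → V} (h : IsDiagonalForm a μ e ψ) {α γ c K : ℝ}
    (hγ : 0 < γ) (hα : 3 / 2 < 2 * α + γ) (hc : 0 < c) {N : ℕ+}
    (hN : ∀ n, N ≤ n → c * (n : ℝ) ^ γ ≤ μ n ∧
      ∀ m, m ≠ n → c * (gapWeight γ n m)⁻¹ ≤ |μ m - μ n|) (φ : ℕ+ → V)
    (hφ : ∀ n, N ≤ n → ∀ m, ‖⟪e m, (φ n : H) - e n⟫_ℂ‖
      ≤ K * ((m : ℝ) ^ (-α) * (n : ℝ) ^ (-α)) * invGap μ (c * (n : ℝ) ^ (γ - 1)) n m) :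
    Summable fun n : ℕ+ => energyNorm a (((μ n ^ (-(1 / 2) : ℝ) : ℝ) : ℂ) • ψ n -
      ((μ n ^ (-(1 / 2) : ℝ) : ℝ) : ℂ) • φ n) ^ 2 := by
  have hsum := ((summable_rpow_mul_gapWeight_sq hγ hα).add
    (summable_rpow_mul_gapWeight hγ (by linarith : 1 < 2 * α + γ))).mul_left (K ^ 2 * (c⁻¹) ^ 2)
  refine Summable.of_norm_bounded_eventually hsum.prod ?_
  have hfin : {n : ℕ+ | ¬ N ≤ n}.Finite :=
    (Finset.finite_toSet (Finset.Iic N)).subset fun n hn => by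
      simpa using (not_le.1 hn).le
  refine Filter.mem_of_superset hfin.compl_mem_cofinite fun n hn => ?_
  have hn : N ≤ n := by simpa using hn
  change ‖_‖ ≤ _
  rw [Real.norm_of_nonneg (sq_nonneg _)]
  refine hasSum_le (fun m => ?_) (h.hasSum_energyNorm_sq _) (hsum.prod_factor n).hasSum
  have hμn := h.pos n
  have hμm := h.pos m
  have hcoe : (((((μ n ^ (-(1 / 2) : ℝ) : ℝ) : ℂ) • ψ n -
      ((μ n ^ (-(1 / 2) : ℝ) : ℝ) : ℂ) • φ n : V)) : H)
      = -(((μ n ^ (-(1 / 2) : ℝ) : ℝ) : ℂ) • ((φ n : H) - e n)) := by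
    rw [Submodule.coe_sub, Submodule.coe_smul, Submodule.coe_smul, h.coe_eq, smul_sub]
    abel
  have hsq : (μ n ^ (-(1 / 2) : ℝ)) ^ 2 = (μ n)⁻¹ := by
    rw [← Real.rpow_natCast, ← Real.rpow_mul hμn.le, ← Real.rpow_neg_one]
    norm_num
  rw [hcoe, inner_neg_right, norm_neg, inner_smul_right, norm_mul, mul_pow, Complex.norm_real,
    Real.norm_of_nonneg (by positivity), hsq]
  have hn0 : (0 : ℝ) < n := by linarith [one_le_coe n]
  have hm0 : (0 : ℝ) < m := by linarith [one_le_coe m]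
  have h2α : ∀ x : ℝ, 0 < x → (x ^ (-α)) ^ 2 = x ^ (-(2 * α)) := fun x hx => by
    rw [← Real.rpow_natCast, ← Real.rpow_mul hx.le]; congr 1; push_cast; ring
  have h1 := pow_le_pow_left₀ (norm_nonneg _) (hφ n hn m) 2
  have h2 := div_mul_invGap_sq_le hc h.pos (hN n hn).1 (hN n hn).2 m
  rw [mul_pow, mul_pow, mul_pow, h2α _ hn0, h2α _ hm0] at h1
  calc _ ≤ μ m * ((μ n)⁻¹ * (K ^ 2 * ((m : ℝ) ^ (-(2 * α)) * (n : ℝ) ^ (-(2 * α))) *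
        invGap μ (c * (n : ℝ) ^ (γ - 1)) n m ^ 2)) := by gcongr
    _ = K ^ 2 * ((m : ℝ) ^ (-(2 * α)) * (n : ℝ) ^ (-(2 * α))) *
        (μ m / μ n * invGap μ (c * (n : ℝ) ^ (γ - 1)) n m ^ 2) := by
          rw [div_eq_mul_inv]; ring
    _ ≤ K ^ 2 * ((m : ℝ) ^ (-(2 * α)) * (n : ℝ) ^ (-(2 * α))) *
        ((c⁻¹) ^ 2 * (gapWeight γ n m ^ 2 + (n : ℝ) ^ (-γ) * gapWeight γ n m)) :=
          mul_le_mul_of_nonneg_left h2 (by positivity)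
    _ = K ^ 2 * (c⁻¹) ^ 2 * ((n : ℝ) ^ (-(2 * α)) * (m : ℝ) ^ (-(2 * α)) * gapWeight γ n m ^ 2 +
        (n : ℝ) ^ (-(2 * α)) * (n : ℝ) ^ (-γ) * ((m : ℝ) ^ (-(2 * α)) * gapWeight γ n m)) := by
          ring
    _ = _ := by rw [← Real.rpow_add hn0, ← neg_add]

theorem isOpen_box (κ γ μ : ℝ) (n : ℕ+) : IsOpen (box κ γ μ n) :=
  (isOpen_lt continuous_const Complex.continuous_re).inter
    ((isOpen_lt Complex.continuous_re continuous_const).inter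
      (isOpen_lt Complex.continuous_im.abs continuous_const))

theorem box_subset (κ γ μ : ℝ) (n : ℕ+) : box κ γ μ n ⊆
    Set.Icc (μ - κ / 2 * ((n : ℝ) - 1) ^ (γ - 1)) (μ + κ / 2 * (n : ℝ) ^ (γ - 1)) ×ℂ
      Set.Icc (-(κ / 2 * (n : ℝ) ^ (γ - 1))) (κ / 2 * (n : ℝ) ^ (γ - 1)) :=
  fun _ hz => ⟨⟨hz.1.le, hz.2.1.le⟩, abs_le.1 hz.2.2.le⟩

theorem frontier_box_subset (κ γ μ : ℝ) (n : ℕ+) : frontier (box κ γ μ n) ⊆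
    Set.Icc (μ - κ / 2 * ((n : ℝ) - 1) ^ (γ - 1)) (μ + κ / 2 * (n : ℝ) ^ (γ - 1)) ×ℂ
      Set.Icc (-(κ / 2 * (n : ℝ) ^ (γ - 1))) (κ / 2 * (n : ℝ) ^ (γ - 1)) :=
  frontier_subset_closure.trans
    (closure_minimal (box_subset κ γ μ n) (isClosed_Icc.reProdIm isClosed_Icc))

theorem isDiagonalForm_of_eigenbasis [CompleteSpace H] {V : Submodule ℂ H}
    (hV : Dense (V : Set H)) {a : SesqForm V} (ha_herm : IsHermitianForm a)
    (ha_pos : IsPosDefForm a) (ha_closed : IsClosedForm a) {μ : ℕ+ → ℝ} {ψ : ℕ+ → V}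
    (hψ_orth : Orthonormal ℂ (fun n => (ψ n : H)))
    (hψ_complete : Dense (Submodule.span ℂ (Set.range (fun n => (ψ n : H))) : Set H))
    (hψ_eig : ∀ n, IsEigenpair (formOperator a) (μ n) (ψ n)) :
    ∃ e : HilbertBasis ℕ+ ℂ H, IsDiagonalForm a μ e ψ := by
  have hsp : ⊤ ≤ (Submodule.span ℂ (Set.range (fun n => (ψ n : H)))).topologicalClosure :=
    (Submodule.dense_iff_topologicalClosure_eq_top.1 hψ_complete).ge
  have hcoe : ∀ i, (ψ i : H) = HilbertBasis.mk hψ_orth hsp i := fun i => by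
    rw [HilbertBasis.coe_mk]
  have happ : ∀ i v, a (ψ i) v = μ i * ⟪(v : H), (ψ i : H)⟫_ℂ := fun i v => by
    have := (hψ_eig i).2
    rw [formOperator_graph hV] at this
    obtain ⟨_, hu⟩ := this
    have h1 := hu v
    rwa [inner_smul_right] at h1
  have hnonneg : ∀ u : V, 0 ≤ (a u u).re := fun u => by
    rcases eq_or_ne u 0 with rfl | hu
    · simp
    · exact (ha_pos u hu).le
  refine ⟨HilbertBasis.mk hψ_orth hsp, ha_herm, ha_closed, hnonneg, hcoe, fun i => ?_,
    fun i v => by rw [← hcoe]; exact happ i v⟩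
  have h1 := ha_pos (ψ i) fun h0 => (hψ_eig i).1 (by rw [h0]; rfl)
  rw [happ, inner_self_eq_norm_sq_to_K, hψ_orth.1 i] at h1
  simpa using h1

end

end FormPerturbation

end

theorem mainTheorem6 {H : Type*} [NormedAddCommGroup H] [InnerProductSpace ℂ H] [CompleteSpace H]
    (V : Submodule ℂ H) (hV : Dense (V : Set H))
    (a b : FormPerturbation.SesqForm V)
    (ha_herm : FormPerturbation.IsHermitianForm a)
    (ha_pos : FormPerturbation.IsPosDefForm a)
    (ha_closed : FormPerturbation.IsClosedForm a)
    (hb_cont : FormPerturbation.IsSeparatelyContinuous a b)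
    (μ : ℕ+ → ℝ) (ψ : ℕ+ → V)
    (hψ_orth : Orthonormal ℂ (fun n => (ψ n : H)))
    (hψ_complete : Dense (Submodule.span ℂ (Set.range (fun n => (ψ n : H))) : Set H))
    (hψ_eig : ∀ n, FormPerturbation.IsEigenpair (FormPerturbation.formOperator a) (μ n) (ψ n))
    (γ κ : ℝ) (N₀ : ℕ+) (hγ : 0 < γ) (hκ : 0 < κ)
    (hgap : ∀ k : ℕ+, N₀ ≤ k → κ * (k : ℝ) ^ (γ - 1) ≤ μ (k + 1) - μ k)
    (α M : ℝ) (hM : 0 < M)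
    (hb_sub : ∀ m n : ℕ+, ‖b (ψ m) (ψ n)‖ ≤ M / ((m : ℝ) ^ α * (n : ℝ) ^ α))
    (hα₁ : α ≤ 1 → 3 / 2 < 2 * α + γ)
    (hα₂ : 1 < α → 1 < 2 * α + γ) :
    (∃ N : ℕ+, ∀ n : ℕ+, N ≤ n →
      frontier (FormPerturbation.box κ γ (μ n) n) ⊆
        FormPerturbation.resolventSet (FormPerturbation.formOperator (a + b)) ∧
      ∃ z ∈ FormPerturbation.box κ γ (μ n) n,
        (∀ w ∈ FormPerturbation.box κ γ (μ n) n,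
          w ∉ FormPerturbation.resolventSet (FormPerturbation.formOperator (a + b)) ↔ w = z) ∧
        FormPerturbation.IsSimpleEigenpair (FormPerturbation.formOperator (a + b)) z
          (FormPerturbation.rieszVector (FormPerturbation.formOperator (a + b))
            κ γ (μ n) n (ψ n))) ∧
    ∀ φ : ℕ+ → V,
      (∃ N : ℕ+, ∀ n : ℕ+, N ≤ n →
        (φ n : H) = FormPerturbation.rieszVector (FormPerturbation.formOperator (a + b))
          κ γ (μ n) n (ψ n)) →
      Summable (fun n : ℕ+ =>
        FormPerturbation.energyNorm a
          (((μ n ^ (-(1 / 2) : ℝ) : ℝ) : ℂ) • ψ n -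
            ((μ n ^ (-(1 / 2) : ℝ) : ℝ) : ℂ) • φ n) ^ 2) := by
  open FormPerturbation in
  have hα : 3 / 2 < 2 * α + γ := by
    rcases le_or_gt α 1 with h | h
    · exact hα₁ h
    -- For `α > 1`, positivity of `γ` already gives `2α + γ > 2`, so both regimes share the bound `3
    -- / 2`.
    · linarith [hα₂ h]
  obtain ⟨e, hd⟩ := isDiagonalForm_of_eigenbasis hV ha_herm ha_pos ha_closed hψ_orth hψ_complete
    hψ_eig
  obtain ⟨c, hc, hcμ, N₁, hN₁⟩ := exists_gap_estimates hd.pos hγ hκ hgap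
  obtain ⟨C, r, hr, hC⟩ := exists_tsum_gapWeight_le (α := α) hγ (by linarith)
  have htend : Filter.Tendsto (fun x : ℕ => M * (c⁻¹ * (C * (x : ℝ) ^ (-r)))) Filter.atTop
      (nhds 0) := by
    have h1 := ((((tendsto_rpow_neg_atTop hr).comp
      tendsto_natCast_atTop_atTop).const_mul C).const_mul c⁻¹).const_mul M
    simpa using h1
  -- Beyond `L` the rescaled perturbation meets the smallness threshold `1 / 64` of
  -- `exists_eigenvalue_near`.
  obtain ⟨L, hL⟩ := Filter.eventually_atTop.1
    (htend.eventually_le_const (show (0 : ℝ) < 1 / 64 by norm_num))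
  have hk : ∀ i j, ‖b (ψ j) (ψ i)‖ ≤ M * ((i : ℝ) ^ (-α) * (j : ℝ) ^ (-α)) := fun i j => by
    refine (hb_sub j i).trans (le_of_eq ?_)
    rw [Real.rpow_neg (by positivity), Real.rpow_neg (by positivity), div_eq_mul_inv, mul_inv]
    ring
  have hnear : ∀ n : ℕ+, max N₁ L.succPNat ≤ n → _ := fun n hn =>
    hd.exists_eigenvalue_near hV hb_cont (β := fun i => (i : ℝ) ^ (-α)) hM.le
      (fun i => by positivity) hk hc hcμ n (l := κ / 2 * ((n : ℝ) - 1) ^ (γ - 1))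
      (r := κ / 2 * (n : ℝ) ^ (γ - 1)) (δ := c * (n : ℝ) ^ (γ - 1))
      (mul_pos hc (Real.rpow_pos_of_pos (by linarith [one_le_coe n]) _))
      (hN₁ n ((le_max_left _ _).trans hn)).2.2.2.2.1 (hN₁ n ((le_max_left _ _).trans hn)).2.2.2.2.2
      (fun m hm => by linarith [(hN₁ n ((le_max_left _ _).trans hn)).2.1 m hm])
      (fun m hm => by linarith [(hN₁ n ((le_max_left _ _).trans hn)).2.2.1 m hm])
  have hsmall : ∀ n : ℕ+, max N₁ L.succPNat ≤ n →
      Summable (fun m : ℕ+ => ((m : ℝ) ^ (-α)) ^ 2 * invGap μ (c * (n : ℝ) ^ (γ - 1)) n m) ∧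
      M * ∑' m : ℕ+, ((m : ℝ) ^ (-α)) ^ 2 * invGap μ (c * (n : ℝ) ^ (γ - 1)) n m ≤ 1 / 64 := by
    intro n hn
    have hg := (hN₁ n ((le_max_left _ _).trans hn)).2.2.2.1
    have hLn : L ≤ n := by
      have h1 : L.succPNat ≤ n := (le_max_right _ _).trans hn
      exact (Nat.le_succ L).trans h1
    have hle : ∀ m : ℕ+, ((m : ℝ) ^ (-α)) ^ 2 * invGap μ (c * (n : ℝ) ^ (γ - 1)) n m
        ≤ c⁻¹ * ((m : ℝ) ^ (-(2 * α)) * gapWeight γ n m) := fun m => by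
      have h1 : ((m : ℝ) ^ (-α)) ^ 2 = (m : ℝ) ^ (-(2 * α)) := by
        rw [← Real.rpow_natCast, ← Real.rpow_mul (by positivity)]; congr 1; push_cast; ring
      rw [h1, mul_left_comm]
      exact mul_le_mul_of_nonneg_left (invGap_le hc hg m) (by positivity)
    have hs := ((hC n).1.mul_left c⁻¹).of_nonneg_of_le
      (fun m => mul_nonneg (sq_nonneg _) (invGap_pos hc hg m).le) hle
    refine ⟨hs, le_trans (mul_le_mul_of_nonneg_left ?_ hM.le) (hL n hLn)⟩
    refine (hs.tsum_le_tsum hle ((hC n).1.mul_left c⁻¹)).trans ?_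
    rw [tsum_mul_left]
    exact mul_le_mul_of_nonneg_left (hC n).2 (inv_pos.2 hc).le
  constructor
  · refine ⟨max N₁ L.succPNat, fun n hn => ?_⟩
    obtain ⟨w, hw1, hw2, hw3, hw4, hwr, hws, -⟩ := hnear n hn (hsmall n hn).1 (hsmall n hn).2
    have hw : w ∈ box κ γ (μ n) n := ⟨hw1, hw2, abs_lt.2 ⟨hw3, hw4⟩⟩
    refine ⟨fun z hz => ?_, w, hw, fun z hz => hwr z (box_subset _ _ _ _ hz), ?_⟩
    -- The only spectral point of the closed rectangle is `w`, which lies in the open box and so not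
    -- on its frontier.
    · by_contra hzr
      rw [(hwr z (frontier_box_subset _ _ _ _ hz)).1 hzr, (isOpen_box κ γ (μ n) n).frontier_eq] at hz
      exact hz.2 hw
    · rw [rieszVector, hd.coe_eq]
      exact hws
  · rintro φ ⟨N₂, hN₂⟩
    refine hd.summable_energyNorm_sq hγ hα hc (K := 32 * M) (N := max N₂ (max N₁ L.succPNat))
      (fun n hn => ?_) φ fun n hn m => ?_
    · have h1 := hN₁ n ((le_max_left _ _).trans ((le_max_right _ _).trans hn))
      exact ⟨h1.1, h1.2.2.2.1⟩
    · have hn' := (le_max_right _ _).trans hn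
      obtain ⟨w, -, -, -, -, -, -, hwe⟩ := hnear n hn' (hsmall n hn').1 (hsmall n hn').2
      rw [hN₂ n ((le_max_left _ _).trans hn), rieszVector, hd.coe_eq]
      exact hwe m
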